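/- Let $G=(V,E)$ be a finite directed graph without self-loops and without parallel edges (opposite edges $(u,v)$, $(v,u)$ are allowed), with at least one edge, whose underlying undirected graph $U(G)$ (obtained by forgetting the orientation of the edges) is connected. Suppose that $G$ is Eulerian, i.e. that it has an Eulerian circuit: a closed walk that passes through every edge exactly once. Two Eulerian circuits are regarded as the same if their sequences of edges are cyclic rotations of each other. For $v\in V$ let $d(v)$ be the number of out-neighbours of $v$, call $v$ a cut node of $U(G)$ if the graph obtained from $U(G)$ by deleting $v$ and its incident edges is not connected, and put \[ A(G)=\{v\in V : d(v)=1, \text{ or } d(v)=2 \text{ and } v \text{ is a cut node of } U(G)\}. \] Then $G$ has a unique Eulerian circuit if and only if $A(G)=V$. Moreover, whether this is the case can be decided in time $O(|E|)$: there is a single random access machine program (unit-cost additions, subtractions, comparisons and indirect memory accesses, on words bounded by $O(|E|)$, i.e. of $\log_2|E|+O(1)$ bits) which, given any such $G$ with $V=\{0,\dots,n-1\}$ as the number $n$, the number $|E|$ and a list of the edges in arbitrary order, halts after $O(|E|)$ steps with the correct answer. -/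

import Mathlib

namespace EulerianCircuits

/-! ### Digraphs, walks, Eulerian circuits

A digraph without parallel edges is Mathlib's `Digraph V`; the absence of self-loops is the
predicate `Loopless`. -/

section Graph

variable {V : Type*}

/-- No self-loops. -/
def Loopless (G : Digraph V) : Prop := ∀ v, ¬ G.Adj v v

/-- The edge set `E(G)`. -/
def edgeSet (G : Digraph V) : Set (V × V) := {e | G.Adj e.1 e.2}

/-- The underlying undirected graph `U(G)`. -/
def U (G : Digraph V) : SimpleGraph V := G.toSimpleGraphInclusive

/-- `G` is weakly connected: `U(G)` is connected (in particular `V` is non-empty). -/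
def WeaklyConnected (G : Digraph V) : Prop := (U G).Connected

/-- The string of edges `(v₀,v₁), (v₁,v₂), …, (v_{k-1},v_k)` of a sequence of nodes
`(v₀,…,v_k)`. -/
def walkEdges (W : List V) : List (V × V) := W.zip W.tail

/-- `W = (v₀,…,v_k)` is a walk: there is an edge from each node to the next one. -/
def IsWalk (G : Digraph V) (W : List V) : Prop :=
  W ≠ [] ∧ ∀ e ∈ walkEdges W, e ∈ edgeSet G

/-- `W` is a circuit: a walk with `v₀ = v_k`. -/
def IsCircuit (G : Digraph V) (W : List V) : Prop :=
  IsWalk G W ∧ W.head? = W.getLast?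

/-- `W` is an Eulerian circuit: a circuit that passes through every edge exactly once. -/
def IsEulerianCircuit (G : Digraph V) (W : List V) : Prop :=
  IsCircuit G W ∧ (walkEdges W).Nodup ∧ ∀ e ∈ edgeSet G, e ∈ walkEdges W

/-- `G` has an Eulerian circuit. -/
def IsEulerian (G : Digraph V) : Prop := ∃ W, IsEulerianCircuit G W

/-- `G` has exactly one Eulerian circuit. Circuits are cyclic objects: two of them are the same
if their strings of edges are cyclic rotations of each other. -/
def HasUniqueEulerianCircuit (G : Digraph V) : Prop :=
  ∃ W, IsEulerianCircuit G W ∧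
    ∀ W', IsEulerianCircuit G W' → walkEdges W' ~r walkEdges W

/-- `d(v)`: the number of out-neighbours of `v`. -/
noncomputable def outDeg (G : Digraph V) (v : V) : ℕ := {w | G.Adj v w}.ncard

/-- `v` is a cut node of `H`: the graph `H \ v` is not connected. -/
def IsCutNode (H : SimpleGraph V) (v : V) : Prop := ¬ (H.induce {v}ᶜ).Connected

/-- The set `A(G)`. -/
def A (G : Digraph V) : Set V :=
  {v | outDeg G v = 1 ∨ (outDeg G v = 2 ∧ IsCutNode (U G) v)}

end Graph

/-! ### Word RAM programs with a step count

A random access machine with registers (named by the program, hence finitely many of them are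
used) and a memory with indirect addressing. Every word is a natural number below a bound `W`,
i.e. has `log₂ W` bits; an instruction whose result would not fit has no execution. Programs are
structured (sequence, conditional, loop); every instruction and every test takes one step. -/

namespace RAM

structure State where
  reg : ℕ → ℕ
  mem : ℕ → ℕ

inductive Instr where
  /-- `r := k` -/
  | const (r k : ℕ)
  /-- `r := a` -/
  | copy (r a : ℕ)
  /-- `r := a + b` -/
  | add (r a b : ℕ)
  /-- `r := a - b` (truncated at `0`) -/
  | sub (r a b : ℕ)
  /-- `r := mem[a]` -/
  | load (r a : ℕ)
  /-- `mem[a] := b` -/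
  | store (a b : ℕ)

/-- The value that the instruction writes. -/
def Instr.value : Instr → State → ℕ
  | .const _ k, _ => k
  | .copy _ a, s => s.reg a
  | .add _ a b, s => s.reg a + s.reg b
  | .sub _ a b, s => s.reg a - s.reg b
  | .load _ a, s => s.mem (s.reg a)
  | .store _ b, s => s.reg b

/-- The state after the instruction. -/
def Instr.next (i : Instr) (s : State) : State :=
  match i with
  | .const r _ | .copy r _ | .add r _ _ | .sub r _ _ | .load r _ =>
    { s with reg := Function.update s.reg r (i.value s) }
  | .store a _ => { s with mem := Function.update s.mem (s.reg a) (i.value s) }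

/-- Comparison of two registers. -/
inductive Test where
  | lt (a b : ℕ)
  | eq (a b : ℕ)

def Test.Holds : Test → State → Prop
  | .lt a b, s => s.reg a < s.reg b
  | .eq a b, s => s.reg a = s.reg b

inductive Program where
  | skip
  | instr (i : Instr)
  | seq (p q : Program)
  | ite (c : Test) (p q : Program)
  | loop (c : Test) (p : Program)

/-- `Exec W p s t s'`: with words below `W`, the program `p` started in the state `s` halts after
exactly `t` steps in the state `s'`. Here `loop c p` is "while `c` do `p`". -/
inductive Exec (W : ℕ) : Program → State → ℕ → State → Prop where
  | skip (s : State) : Exec W .skip s 1 s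
  | instr (i : Instr) (s : State) (h : i.value s < W) : Exec W (.instr i) s 1 (i.next s)
  | seq {p q : Program} {s₁ s₂ s₃ : State} {t₁ t₂ : ℕ}
      (hp : Exec W p s₁ t₁ s₂) (hq : Exec W q s₂ t₂ s₃) :
      Exec W (.seq p q) s₁ (t₁ + t₂) s₃
  | ite_true {c : Test} {p q : Program} {s s' : State} {t : ℕ}
      (hc : c.Holds s) (hp : Exec W p s t s') : Exec W (.ite c p q) s (t + 1) s'
  | ite_false {c : Test} {p q : Program} {s s' : State} {t : ℕ}
      (hc : ¬ c.Holds s) (hq : Exec W q s t s') : Exec W (.ite c p q) s (t + 1) s'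
  | loop_false {c : Test} {p : Program} {s : State}
      (hc : ¬ c.Holds s) : Exec W (.loop c p) s 1 s
  | loop_true {c : Test} {p : Program} {s₁ s₂ s₃ : State} {t₁ t₂ : ℕ}
      (hc : c.Holds s₁) (hp : Exec W p s₁ t₁ s₂) (hl : Exec W (.loop c p) s₂ t₂ s₃) :
      Exec W (.loop c p) s₁ (t₁ + t₂ + 1) s₃

end RAM

/-- `L` lists every edge of the digraph `G` on the nodes `0, …, n-1` once, in some order. -/
def IsEdgeList {n : ℕ} (G : Digraph (Fin n)) (L : List (Fin n × Fin n)) : Prop :=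
  L.Nodup ∧ ∀ e, e ∈ L ↔ e ∈ edgeSet G

/-- The input as a string of words: the number of nodes, the number of edges, then the tail and
the head of each edge in the order of the list. -/
def inputWords (n : ℕ) (L : List (Fin n × Fin n)) : List ℕ :=
  n :: L.length :: L.flatMap fun e => [(e.1 : ℕ), (e.2 : ℕ)]

/-- The initial state: the input is at the memory cells `0, 1, 2, …`; all other cells and all
registers are `0`. -/
def initState (n : ℕ) (L : List (Fin n × Fin n)) : RAM.State where
  reg _ := 0
  mem i := (inputWords n L).getD i 0

end EulerianCircuits

/-! Circuits are treated as strings of edges (`IsTour`), and connectivity as the statement that a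
two-colouring constant along edges is constant (`ConnOn`).

Uniqueness forces A(G) = V by an exchange. If a circuit reads ABCD with A, C leading from v to x and
B, D from x to v, then ADCB is a circuit too and not a rotation of the first
(`false_of_parallel_sections`). Three departures from v give such sections with x = v and C empty,
so d(v) ≤ 2. If d(v) = 2, the circuit consists of two closed walks at v; they cannot meet elsewhere,
so v is a cut node. Conversely, let two different circuits start with the same edge and diverge
after an edge e into v. If d(v) = 2, each consists of two closed walks at v, and the one that ends
with e starts with a different out-edge of v in each circuit. So both out-neighbours of v are joined
to the tail of e in G \ v, which is therefore connected (`connOn_compl_of_divergence`).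

The program rejects if some degree exceeds two. Otherwise it removes nodes v of degree one: a path u
→ v → w becomes an edge u → w, and if u = w the 2-cycle is deleted. The truth of `AllCut` is
preserved (`allCut_contract`, `allCut_remove_cycle`). When no node of degree one is left, a
non-empty connected remainder has a non-cut node of degree two, so the condition holds exactly if no
edge remains (`Admissible.allCut_iff_eq_zero`). Instead of adjacency lists, each node stores its
degree and the sums of its out- and in-neighbours; at degree one these sums are the neighbours, and
every update takes constant time. Each round either lowers the number of edges or advances a scan of
the nodes. After a reduction only u can be a new node of degree one, so the search goes on there. -/

namespace EulerianCircuits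

/-! ### Connectivity in terms of two-colourings -/

section Connectivity

variable {V : Type*}

/-- The edges in `E` that join nodes of `S` connect `S`, in terms of two-colourings: a colouring
that is constant along these edges is constant on `S`. -/
def ConnOn (E : Set (V × V)) (S : Set V) : Prop :=
  ∀ c : V → Prop, (∀ p q, (p, q) ∈ E → p ∈ S → q ∈ S → (c p ↔ c q)) →
    ∀ a ∈ S, ∀ b ∈ S, (c a ↔ c b)

/-- `U G` unfolds to a graph of this form, so the criterion covers both weak connectivity and cut
nodes. -/
theorem connected_induce_fromRel_iff (E : Set (V × V)) (S : Set V) :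
    ((SimpleGraph.fromRel fun a b => (a, b) ∈ E).induce S).Connected ↔
      S.Nonempty ∧ ConnOn E S := by
  rw [SimpleGraph.connected_iff]
  constructor
  · rintro ⟨hp, ⟨x⟩⟩
    refine ⟨⟨x, x.2⟩, fun c hc a ha b hb => ?_⟩
    obtain ⟨w⟩ := hp ⟨a, ha⟩ ⟨b, hb⟩
    have key : ∀ {x y : S}, ((SimpleGraph.fromRel fun a b => (a, b) ∈ E).induce S).Walk x y →
        (c x ↔ c y) := by
      intro x y w
      induction w with
      | nil => exact Iff.rfl
      | @cons u v w h _ ih =>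
        refine Iff.trans ?_ ih
        simp only [SimpleGraph.comap_adj, SimpleGraph.fromRel_adj, Function.Embedding.subtype_apply]
          at h
        rcases h.2 with h | h
        · exact hc _ _ h u.2 v.2
        · exact (hc _ _ h v.2 u.2).symm
    exact key w
  · rintro ⟨⟨x, hx⟩, hc⟩
    refine ⟨fun a b => ?_, ⟨⟨x, hx⟩⟩⟩
    set H := (SimpleGraph.fromRel fun a b => (a, b) ∈ E).induce S with hH
    have key := hc (fun y => ∃ h : y ∈ S, H.Reachable a ⟨y, h⟩) (by
      intro p q hpq hp hq
      have hadj : p = q ∨ H.Adj ⟨p, hp⟩ ⟨q, hq⟩ := by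
        by_cases h : p = q
        · exact Or.inl h
        · refine Or.inr ?_
          simp only [hH, SimpleGraph.comap_adj, SimpleGraph.fromRel_adj,
            Function.Embedding.subtype_apply]
          exact ⟨h, Or.inl hpq⟩
      rcases hadj with rfl | hadj
      · exact Iff.rfl
      · exact ⟨fun ⟨_, h⟩ => ⟨hq, h.trans hadj.reachable⟩,
          fun ⟨_, h⟩ => ⟨hp, h.trans hadj.symm.reachable⟩⟩) a a.2 b b.2
    exact (key.1 ⟨a.2, SimpleGraph.Reachable.refl _⟩).2

theorem connected_fromRel_iff (E : Set (V × V)) :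
    (SimpleGraph.fromRel fun a b => (a, b) ∈ E).Connected ↔
      Nonempty V ∧ ConnOn E Set.univ := by
  rw [Set.nonempty_iff_univ_nonempty, ← connected_induce_fromRel_iff]
  exact (SimpleGraph.induceUnivIso _).connected_iff.symm

theorem weaklyConnected_iff (G : Digraph V) :
    WeaklyConnected G ↔ Nonempty V ∧ ConnOn (edgeSet G) Set.univ :=
  connected_fromRel_iff (edgeSet G)

theorem isCutNode_iff (G : Digraph V) (v : V) :
    IsCutNode (U G) v ↔ ¬ (({v}ᶜ : Set V).Nonempty ∧ ConnOn (edgeSet G) {v}ᶜ) :=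
  not_congr (connected_induce_fromRel_iff (edgeSet G) _)

end Connectivity

/-! ### Eulerian circuits as strings of edges -/

section Tours

variable {V : Type*}

/-- `L` is the string of edges of a walk from `a` to `b`. -/
def EdgeWalk : V → List (V × V) → V → Prop
  | a, [], b => a = b
  | a, e :: L, b => e.1 = a ∧ EdgeWalk e.2 L b

theorem edgeWalk_append {a b : V} {L₁ L₂ : List (V × V)} :
    EdgeWalk a (L₁ ++ L₂) b ↔ ∃ c, EdgeWalk a L₁ c ∧ EdgeWalk c L₂ b := by
  induction L₁ generalizing a with
  | nil => simp [EdgeWalk]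
  | cons e L ih => simp [EdgeWalk, ih, and_assoc]

theorem EdgeWalk.walkEdges_eq {a b : V} {L : List (V × V)} (h : EdgeWalk a L b) :
    walkEdges (a :: L.map Prod.snd) = L ∧ (a :: L.map Prod.snd).getLast? = some b := by
  induction L generalizing a with
  | nil => simpa [walkEdges, EdgeWalk] using h
  | cons e L ih =>
    obtain ⟨rfl, h⟩ := h
    obtain ⟨h₁, h₂⟩ := ih h
    constructor
    · simp only [walkEdges, List.tail_cons, List.map_cons, List.zip_cons_cons] at h₁ ⊢
      rw [h₁]
    · simpa [List.getLast?_cons_cons] using h₂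

theorem edgeWalk_walkEdges (a : V) (T : List V) {b : V} (h : (a :: T).getLast? = some b) :
    EdgeWalk a (walkEdges (a :: T)) b := by
  induction T generalizing a with
  | nil => simpa [walkEdges, EdgeWalk] using h
  | cons x T ih =>
    refine ⟨rfl, ih x ?_⟩
    simpa [List.getLast?_cons_cons] using h

/-- `L` is the string of edges of an Eulerian circuit. -/
structure IsTour (G : Digraph V) (L : List (V × V)) : Prop where
  closed : ∃ a, EdgeWalk a L a
  nodup : L.Nodup
  mem_iff : ∀ e, e ∈ L ↔ e ∈ edgeSet G

theorem isTour_iff (G : Digraph V) (L : List (V × V)) :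
    IsTour G L ↔ ∃ W, IsEulerianCircuit G W ∧ walkEdges W = L := by
  constructor
  · rintro ⟨⟨a, ha⟩, hn, hm⟩
    obtain ⟨h₁, h₂⟩ := ha.walkEdges_eq
    refine ⟨_, ⟨⟨⟨by simp, ?_⟩, ?_⟩, ?_, ?_⟩, h₁⟩
    · rw [h₁]; exact fun e he => (hm e).1 he
    · rw [h₂]; rfl
    · rwa [h₁]
    · rw [h₁]; exact fun e he => (hm e).2 he
  · rintro ⟨W, ⟨⟨⟨hne, hw⟩, hc⟩, hn, hm⟩, rfl⟩
    cases W with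
    | nil => exact absurd rfl hne
    | cons a T =>
      exact ⟨⟨a, edgeWalk_walkEdges a T hc.symm⟩, hn, fun e => ⟨hw e, hm e⟩⟩

theorem isEulerian_iff (G : Digraph V) : IsEulerian G ↔ ∃ L, IsTour G L := by
  simp only [isTour_iff]
  exact ⟨fun ⟨W, h⟩ => ⟨_, W, h, rfl⟩, fun ⟨_, W, h, _⟩ => ⟨W, h⟩⟩

theorem hasUniqueEulerianCircuit_iff (G : Digraph V) :
    HasUniqueEulerianCircuit G ↔ ∃ L, IsTour G L ∧ ∀ L', IsTour G L' → L' ~r L := by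
  simp only [isTour_iff]
  constructor
  · rintro ⟨W, h, hu⟩
    refine ⟨_, ⟨W, h, rfl⟩, ?_⟩
    rintro _ ⟨W', h', rfl⟩
    exact hu W' h'
  · rintro ⟨_, ⟨W, h, rfl⟩, hu⟩
    exact ⟨W, h, fun W' h' => hu _ ⟨W', h', rfl⟩⟩

theorem IsTour.swap {G : Digraph V} {X Y : List (V × V)} (h : IsTour G (X ++ Y)) :
    IsTour G (Y ++ X) := by
  obtain ⟨⟨a, ha⟩, hn, hm⟩ := h
  obtain ⟨c, h₁, h₂⟩ := edgeWalk_append.1 ha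
  exact ⟨⟨c, edgeWalk_append.2 ⟨a, h₂, h₁⟩⟩, (List.perm_append_comm.nodup_iff).1 hn,
    fun e => by rw [← hm e]; simp [or_comm]⟩

theorem EdgeWalk.start_eq {a b : V} {e : V × V} {L : List (V × V)} (h : EdgeWalk a (e :: L) b) :
    e.1 = a := h.1

/-- A tour can be rotated so that it begins with a given edge. -/
theorem IsTour.exists_rotation {G : Digraph V} {L : List (V × V)} (h : IsTour G L) {e : V × V}
    (he : e ∈ edgeSet G) : ∃ T, L ~r (e :: T) ∧ IsTour G (e :: T) ∧ EdgeWalk e.1 (e :: T) e.1 := by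
  obtain ⟨X, Y, rfl⟩ := List.append_of_mem ((h.mem_iff e).2 he)
  have h' : IsTour G (e :: (Y ++ X)) := h.swap
  refine ⟨Y ++ X, List.isRotated_append, h', ?_⟩
  obtain ⟨a, ha⟩ := h'.closed
  have := ha.1
  subst this
  exact ha

/-- Without repetitions `x` occurs at index zero only, so the rotation is trivial. -/
theorem tail_eq_of_isRotated_cons {α : Type*} {x : α} {T T' : List α} (hn : (x :: T).Nodup)
    (h : (x :: T) ~r (x :: T')) : T = T' := by
  obtain ⟨n, hlt, hr⟩ := List.isRotated_iff_mod.1 h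
  rcases Nat.eq_zero_or_pos n with rfl | hpos
  · simpa using hr
  rcases hlt.lt_or_eq with hlt | rfl
  · have h0 : ((x :: T).rotate n)[0]? = some x := by rw [hr]; rfl
    rw [List.getElem?_rotate (by simp)] at h0
    simp only [Nat.zero_add, Nat.mod_eq_of_lt hlt] at h0
    have h1 : (x :: T)[0]? = some x := rfl
    have := (List.getElem?_inj hlt hn).1 (h0.trans h1.symm)
    omega
  · rw [List.rotate_length] at hr
    simpa using hr

/-- In a cyclic word without repetitions each letter has one successor, but the last letter of `A`
is followed by the first of `B` in one word and by the first of `D` in the other. `C` may be empty.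
-/
theorem not_isRotated_exchange {α : Type*} {A B C D : List α} (hn : (A ++ B ++ C ++ D).Nodup)
    (hA : A ≠ []) (hB : B ≠ []) (hD : D ≠ []) : ¬ (A ++ B ++ C ++ D) ~r (A ++ D ++ C ++ B) := by
  obtain ⟨a, A, rfl⟩ := List.exists_cons_of_ne_nil hA
  obtain ⟨b, B, rfl⟩ := List.exists_cons_of_ne_nil hB
  obtain ⟨d, D, rfl⟩ := List.exists_cons_of_ne_nil hD
  intro h
  simp only [List.cons_append, List.append_assoc] at h hn
  have := tail_eq_of_isRotated_cons hn h
  simp only [List.append_cancel_left_eq, List.cons.injEq] at this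
  obtain ⟨rfl, -⟩ := this
  have := (List.nodup_append.1 (List.nodup_cons.1 hn).2).2.1
  simp at this

/-- Exchanging two parallel sections of a tour gives another tour, so a unique tour has none. -/
theorem false_of_parallel_sections {G : Digraph V} {A B C D : List (V × V)} {v x : V}
    (h : IsTour G (A ++ B ++ C ++ D)) (hu : ∀ L', IsTour G L' → L' ~r (A ++ B ++ C ++ D))
    (hA : EdgeWalk v A x) (hB : EdgeWalk x B v) (hC : EdgeWalk v C x) (hD : EdgeWalk x D v)
    (hA' : A ≠ []) (hB' : B ≠ []) (hD' : D ≠ []) : False := by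
  refine not_isRotated_exchange h.nodup hA' hB' hD' (List.IsRotated.symm (hu _ ⟨⟨v, ?_⟩, ?_, ?_⟩))
  · simp only [edgeWalk_append]
    exact ⟨x, ⟨v, ⟨x, hA, hD⟩, hC⟩, hB⟩
  · refine (List.Perm.nodup_iff ?_).1 h.nodup
    rw [← Multiset.coe_eq_coe]
    simp only [← Multiset.coe_add]
    ac_rfl
  · intro e
    rw [← h.mem_iff e]
    simp only [List.mem_append]
    tauto

theorem EdgeWalk.exists_tail {a b : V} {L : List (V × V)} (h : EdgeWalk a L b) {e : V × V}
    (he : e ∈ L) : e.2 = b ∨ ∃ f ∈ L, f.1 = e.2 := by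
  obtain ⟨X, Y, rfl⟩ := List.append_of_mem he
  obtain ⟨c, -, h⟩ := edgeWalk_append.1 h
  cases Y with
  | nil => exact Or.inl h.2
  | cons f Y => exact Or.inr ⟨f, by simp, h.2.1⟩

/-- In a closed walk the heads of edges are tails of edges. -/
theorem EdgeWalk.exists_tail_of_closed {a : V} {L : List (V × V)} (h : EdgeWalk a L a) {e : V × V}
    (he : e ∈ L) : ∃ f ∈ L, f.1 = e.2 := by
  rcases h.exists_tail he with h' | h'
  · cases L with
    | nil => simp at he
    | cons f L => exact ⟨f, by simp, h.1.trans h'.symm⟩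
  · exact h'

theorem EdgeWalk.exists_split {a b : V} {L : List (V × V)} (h : EdgeWalk a L b) {e : V × V}
    (he : e ∈ L) : ∃ X Y, L = X ++ e :: Y ∧ EdgeWalk a X e.1 ∧ EdgeWalk e.1 (e :: Y) b := by
  obtain ⟨X, Y, rfl⟩ := List.append_of_mem he
  obtain ⟨c, h₁, h₂⟩ := edgeWalk_append.1 h
  have := h₂.1
  subst this
  exact ⟨X, Y, rfl, h₁, h₂⟩

/-- If no edge met `v`, the colour "equal to `v`" would be constant along all edges. -/
theorem exists_edge_of_connOn {E : Set (V × V)} (hc : ConnOn E Set.univ) (hE : E.Nonempty)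
    (hl : ∀ v, (v, v) ∉ E) (v : V) : ∃ w, (v, w) ∈ E ∨ (w, v) ∈ E := by
  by_contra! hv
  obtain ⟨⟨p, q⟩, hpq⟩ := hE
  have key := hc (fun x => x = v) (by
    intro a b hab _ _
    have h1 : a ≠ v := by rintro rfl; exact (hv b).1 hab
    have h2 : b ≠ v := by rintro rfl; exact (hv a).2 hab
    simp [h1, h2])
  have h1 := (key v trivial p trivial).1 rfl
  have h2 := (key v trivial q trivial).1 rfl
  subst h1 h2
  exact hl _ hpq

theorem IsTour.exists_out {G : Digraph V} {L : List (V × V)} (h : IsTour G L) (hl : Loopless G)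
    (hc : WeaklyConnected G) (hE : (edgeSet G).Nonempty) (v : V) : ∃ w, G.Adj v w := by
  obtain ⟨w, hw | hw⟩ := exists_edge_of_connOn ((weaklyConnected_iff G).1 hc).2 hE hl v
  · exact ⟨w, hw⟩
  · obtain ⟨a, ha⟩ := h.closed
    obtain ⟨f, hf, hfv⟩ := ha.exists_tail_of_closed ((h.mem_iff _).2 hw)
    refine ⟨f.2, ?_⟩
    have := (h.mem_iff f).1 hf
    simp only at hfv
    rw [← hfv]
    exact this

/-! ### A unique circuit forces A(G) = V -/

theorem outDeg_le_two_of_unique [Finite V] {G : Digraph V} {L : List (V × V)} (h : IsTour G L)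
    (hu : ∀ L', IsTour G L' → L' ~r L) (v : V) : outDeg G v ≤ 2 := by
  by_contra! hlt
  obtain ⟨x, hx, y, hy, z, hz, hxy, hxz, hyz⟩ := (Set.two_lt_ncard).1 hlt
  obtain ⟨T, hr, ht, hw⟩ := h.exists_rotation (e := (v, x)) hx
  replace hu : ∀ L', IsTour G L' → L' ~r ((v, x) :: T) := fun L' h' => (hu L' h').trans hr
  have three : ∀ f g : V, ∀ X Y Z, T = X ++ (v, f) :: Y ++ (v, g) :: Z → False := by
    rintro f g X Y Z rfl
    rw [List.append_assoc, ← List.cons_append, edgeWalk_append] at hw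
    obtain ⟨c, h₁, h₂⟩ := hw
    obtain rfl : v = c := h₂.start_eq
    rw [edgeWalk_append] at h₂
    obtain ⟨c, h₂, h₃⟩ := h₂
    obtain rfl : v = c := h₃.start_eq
    refine false_of_parallel_sections (A := (v, x) :: X) (B := (v, f) :: Y) (C := [])
      (D := (v, g) :: Z) (G := G) ?_ ?_ h₁ h₂ rfl h₃ (by simp) (by simp) (by simp)
    · simpa using ht
    · simpa using hu
  have my : (v, y) ∈ T := by
    have := (ht.mem_iff (v, y)).2 hy
    simpa [hxy.symm] using this
  have mz : (v, z) ∈ T := by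
    have := (ht.mem_iff (v, z)).2 hz
    simpa [hxz.symm] using this
  obtain ⟨X, Y, rfl⟩ := List.append_of_mem my
  simp only [List.mem_append, List.mem_cons, Prod.mk.injEq, hyz.symm, and_false, false_or] at mz
  rcases mz with mz | mz
  · obtain ⟨P, Q, rfl⟩ := List.append_of_mem mz
    exact three z y P Q Y (by simp)
  · obtain ⟨P, Q, rfl⟩ := List.append_of_mem mz
    exact three y z X P Q (by simp)

theorem isCutNode_of_unique [Finite V] {G : Digraph V} (hl : Loopless G) {L : List (V × V)}
    (h : IsTour G L) (hu : ∀ L', IsTour G L' → L' ~r L) {v : V} (hd : outDeg G v = 2) :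
    IsCutNode (U G) v := by
  rw [isCutNode_iff]
  rintro ⟨-, hc⟩
  obtain ⟨x, y, hxy, hs⟩ := Set.ncard_eq_two.1 hd
  have hx : G.Adj v x := by
    have : x ∈ {w | G.Adj v w} := by rw [hs]; simp
    exact this
  have hy : G.Adj v y := by
    have : y ∈ {w | G.Adj v w} := by rw [hs]; simp
    exact this
  obtain ⟨T, hr, ht, hw⟩ := h.exists_rotation (e := (v, x)) hx
  replace hu : ∀ L', IsTour G L' → L' ~r ((v, x) :: T) := fun L' h' => (hu L' h').trans hr
  have my : (v, y) ∈ T := by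
    have := (ht.mem_iff (v, y)).2 hy
    simpa [hxy.symm] using this
  obtain ⟨X, Y, rfl⟩ := List.append_of_mem my
  rw [← List.cons_append, edgeWalk_append] at hw
  obtain ⟨c, h₁, h₂⟩ := hw
  have hcv := h₂.start_eq
  simp only at hcv
  subst hcv
  -- The two closed walks at `v` do not meet elsewhere: a common node `w` would give parallel
  -- sections between `v` and `w`.
  have disj : ∀ w, w ≠ v → ∀ f ∈ (v, x) :: X, f.1 = w → ∀ g ∈ (v, y) :: Y, g.1 = w → False := by
    rintro w hwv f hf rfl g hg hgf
    obtain ⟨A, B, hAB, hA, hB⟩ := h₁.exists_split hf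
    obtain ⟨C, D, hCD, hC, hD⟩ := h₂.exists_split hg
    rw [hgf] at hC hD
    refine false_of_parallel_sections (A := A) (B := f :: B) (C := C) (D := g :: D) (G := G) ?_ ?_ hA hB
      hC hD ?_ (by simp) (by simp)
    · rw [← List.cons_append, hAB, hCD] at ht
      simpa using ht
    · rw [← List.cons_append, hAB, hCD] at hu
      simpa using hu
    · rintro rfl
      exact hwv (Eq.symm hA)
  -- The colour is membership in the first closed walk. By disjointness no edge avoiding `v` changes
  -- it, yet `x` has it and `y` has not.
  have key := hc (fun w => ∃ f ∈ (v, x) :: X, f.1 = w) (by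
    intro p q hpq hp hq
    have hmem : (p, q) ∈ (v, x) :: X ∨ (p, q) ∈ (v, y) :: Y := by
      have := (ht.mem_iff (p, q)).2 hpq
      rwa [← List.cons_append, List.mem_append] at this
    rcases hmem with hm | hm
    · exact ⟨fun _ => h₁.exists_tail_of_closed hm, fun _ => ⟨_, hm, rfl⟩⟩
    · obtain ⟨g, hg, hgq⟩ := h₂.exists_tail_of_closed hm
      constructor
      · rintro ⟨f, hf, hfp⟩
        exact (disj p hp f hf hfp _ hm rfl).elim
      · rintro ⟨f, hf, hfp⟩
        exact (disj q hq f hf hfp g hg hgq).elim)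
  have hxv : x ≠ v := by rintro rfl; exact hl _ hx
  have hyv : y ≠ v := by rintro rfl; exact hl _ hy
  obtain ⟨f, hf, hfy⟩ := (key x hxv y hyv).1
    (h₁.exists_tail_of_closed (e := (v, x)) (by simp))
  obtain ⟨g, hg, hgy⟩ := h₂.exists_tail_of_closed (e := (v, y)) (by simp)
  exact disj y hyv f hf hfy g hg hgy

/-! ### Two different circuits yield a node outside A(G) -/

theorem exists_divergence {α : Type*} {L L' : List α} (hlen : L.length = L'.length) (hne : L ≠ L') :
    ∃ X f Y f' Y', L = X ++ f :: Y ∧ L' = X ++ f' :: Y' ∧ f ≠ f' := by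
  induction L generalizing L' with
  | nil =>
    cases L' with
    | nil => exact absurd rfl hne
    | cons => simp at hlen
  | cons a L ih =>
    cases L' with
    | nil => simp at hlen
    | cons b L' =>
      by_cases hab : a = b
      · subst hab
        obtain ⟨X, f, Y, f', Y', rfl, rfl, h⟩ := ih (by simpa using hlen) (by simpa using hne)
        exact ⟨a :: X, f, Y, f', Y', rfl, rfl, h⟩
      · exact ⟨[], a, L, b, L', rfl, rfl, hab⟩

/-- Along a walk that never leaves `v`, a colouring of the rest of the graph is constant. -/
theorem EdgeWalk.colour_tail {a b v : V} {L : List (V × V)} (h : EdgeWalk a L b) {c : V → Prop}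
    (hc : ∀ e ∈ L, e.1 ≠ v → e.2 ≠ v → (c e.1 ↔ c e.2)) (hv : ∀ e ∈ L, e.1 ≠ v) :
    ∀ e ∈ L, (c a ↔ c e.1) := by
  induction L generalizing a with
  | nil => simp
  | cons f L ih =>
    obtain ⟨rfl, h⟩ := h
    intro e he
    rcases List.mem_cons.1 he with rfl | he
    · exact Iff.rfl
    · have hfv : f.2 ≠ v := by
        cases L with
        | nil => simp at he
        | cons g L => exact h.1 ▸ hv g (by simp)
      exact (hc f (by simp) (hv f (by simp)) hfv).trans
        (ih h (fun e he => hc e (by simp [he])) (fun e he => hv e (by simp [he])) e he)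

/-- If two tours continue differently after the edge `e` into a node `v` of out-degree two, then
`v` is not a cut node. -/
theorem connOn_compl_of_divergence [Finite V] {G : Digraph V} (hl : Loopless G)
    {Y Y' X : List (V × V)} {e f f' : V × V}
    (h : IsTour G (f :: Y ++ X ++ [e])) (h' : IsTour G (f' :: Y' ++ X ++ [e])) (hff : f ≠ f')
    {v : V} (hev : e.2 = v) (hd : outDeg G v = 2) (hout : ∀ x, ∃ w, G.Adj x w) :
    ConnOn (edgeSet G) {v}ᶜ := by
  have start : ∀ {f Y}, IsTour G (f :: Y ++ X ++ [e]) →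
      f.1 = v ∧ EdgeWalk v (f :: Y ++ X ++ [e]) v := by
    intro f Y h
    obtain ⟨a, ha⟩ := h.closed
    obtain ⟨b, -, hb⟩ := edgeWalk_append.1 ha
    have h1 : e.2 = a := hb.2
    have h2 : f.1 = a := by
      simp only [List.cons_append] at ha
      exact ha.1
    rw [← hev, h1]
    exact ⟨h2, ha⟩
  obtain ⟨hf, hw⟩ := start h
  obtain ⟨hf', hw'⟩ := start h'
  have only : ∀ g ∈ edgeSet G, g.1 = v → g = f ∨ g = f' := by
    intro g hg hgv
    have hadj : ∀ g ∈ edgeSet G, g.1 = v → g.2 ∈ {w | G.Adj v w} := by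
      intro g hg hgv
      have : G.Adj g.1 g.2 := hg
      rwa [hgv] at this
    have m1 := hadj f ((h.mem_iff f).1 (by simp)) hf
    have m2 := hadj f' ((h'.mem_iff f').1 (by simp)) hf'
    have m3 := hadj g hg hgv
    by_contra! hne
    have : 2 < {w | G.Adj v w}.ncard := (Set.two_lt_ncard).2 ⟨f.2, m1, f'.2, m2, g.2, m3,
      fun h => hff (Prod.ext (hf.trans hf'.symm) h),
      fun h => hne.1 (Prod.ext (hgv.trans hf.symm) h.symm),
      fun h => hne.2 (Prod.ext (hgv.trans hf'.symm) h.symm)⟩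
    unfold outDeg at hd
    omega
  -- A tour is cut at its two departures from `v`. This is applied to both tours, with `f` and `f'`
  -- in opposite roles.
  have split : ∀ {f Y f'}, IsTour G (f :: Y ++ X ++ [e]) → EdgeWalk v (f :: Y ++ X ++ [e]) v →
      f'.1 = v → f' ∈ edgeSet G → f ≠ f' → (∀ g ∈ edgeSet G, g.1 = v → g = f ∨ g = f') →
      ∃ P Q, f :: Y ++ X ++ [e] = f :: P ++ f' :: Q ∧ EdgeWalk f.2 P v ∧
        EdgeWalk f'.2 Q v ∧ e ∈ Q ∧ (∀ g ∈ P, g.1 ≠ v) ∧ (∀ g ∈ Q, g.1 ≠ v) := by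
    intro f Y f' h hw hf' hf'E hne only
    have hm : f' ∈ Y ++ X ++ [e] := by
      have := (h.mem_iff f').2 hf'E
      simpa [hne.symm] using this
    obtain ⟨P, Q, hPQ⟩ := List.append_of_mem hm
    have hL : f :: Y ++ X ++ [e] = f :: P ++ f' :: Q := by
      simpa using hPQ
    rw [hL] at h hw
    obtain ⟨c, h₁, h₂⟩ := edgeWalk_append.1 hw
    have hcv : c = v := h₂.1.symm.trans hf'
    subst hcv
    have hn := h.nodup
    refine ⟨P, Q, hL, h₁.2, h₂.2, ?_, ?_, ?_⟩
    -- `Q` is non-empty because `f'` is not a loop, so its last edge is the last edge `e` of the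
    -- tour.
    · rcases List.eq_nil_or_concat Q with rfl | ⟨Q, g, rfl⟩
      · have : f'.2 = f'.1 := h₂.2.trans hf'.symm
        have hadj : G.Adj f'.1 f'.2 := hf'E
        rw [this] at hadj
        exact (hl _ hadj).elim
      · have := congrArg List.getLast? hL
        simp [List.getLast?_append, List.getLast?_cons] at this
        simp [this]
    · intro g hg hgv
      simp only [List.cons_append, List.nodup_cons, List.nodup_append, List.mem_append,
        List.mem_cons] at hn
      rcases only g ((h.mem_iff g).1 (by simp [hg])) hgv with rfl | rfl
      · exact hn.1 (Or.inl hg)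
      · exact hn.2.2.2 _ hg _ (Or.inl rfl) rfl
    · intro g hg hgv
      simp only [List.cons_append, List.nodup_cons, List.nodup_append, List.mem_append,
        List.mem_cons] at hn
      rcases only g ((h.mem_iff g).1 (by simp [hg])) hgv with rfl | rfl
      · exact hn.1 (Or.inr (Or.inr hg))
      · exact hn.2.2.1.1 hg
  obtain ⟨P, Q, hL, hP, hQ, heQ, hPv, hQv⟩ :=
    split h hw hf' ((h'.mem_iff f').1 (by simp)) hff only
  obtain ⟨P', Q', hL', hP', hQ', heQ', hPv', hQv'⟩ :=
    split h' hw' hf ((h.mem_iff f).1 (by simp)) hff.symm (fun g hg hgv => (only g hg hgv).symm)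
  intro c hc
  have colour : ∀ g ∈ edgeSet G, g.1 ≠ v → g.2 ≠ v → (c g.1 ↔ c g.2) :=
    fun g hg h1 h2 => hc g.1 g.2 hg h1 h2
  rw [hL] at h
  rw [hL'] at h'
  have cP := hP.colour_tail (fun g hg => colour g ((h.mem_iff g).1 (by simp [hg]))) hPv
  have cQ := hQ.colour_tail (fun g hg => colour g ((h.mem_iff g).1 (by simp [hg]))) hQv
  have cQ' := hQ'.colour_tail (fun g hg => colour g ((h'.mem_iff g).1 (by simp [hg]))) hQv'
  -- The edge `e` lies in the section after `f'` in one tour and in the section after `f` in the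
  -- other.
  have hcol : c f.2 ↔ c f'.2 := (cQ' e heQ').trans (cQ e heQ).symm
  have all : ∀ x, x ≠ v → (c f.2 ↔ c x) := by
    intro x hx
    obtain ⟨w, hxw⟩ := hout x
    have hm := (h.mem_iff (x, w)).2 hxw
    simp only [List.cons_append, List.mem_append, List.mem_cons] at hm
    rcases hm with rfl | hm | rfl | hm
    · exact (hx hf).elim
    · exact cP _ hm
    · exact (hx hf').elim
    · exact hcol.trans (cQ _ hm)
  exact fun a ha b hb => (all a ha).symm.trans (all b hb)

theorem isRotated_of_forall_mem_A [Finite V] {G : Digraph V} (hl : Loopless G)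
    (hE : (edgeSet G).Nonempty) (hout : ∀ x, ∃ w, G.Adj x w) (hA : A G = Set.univ)
    {L L' : List (V × V)} (h : IsTour G L) (h' : IsTour G L') : L' ~r L := by
  obtain ⟨e₀, he₀⟩ := hE
  obtain ⟨T, hr, ht, -⟩ := h.exists_rotation he₀
  obtain ⟨T', hr', ht', -⟩ := h'.exists_rotation he₀
  suffices e₀ :: T' = e₀ :: T from hr'.trans (this ▸ hr.symm)
  by_contra hne
  have hp : (e₀ :: T').Perm (e₀ :: T) := (List.perm_ext_iff_of_nodup ht'.nodup ht.nodup).2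
    fun e => (ht'.mem_iff e).trans (ht.mem_iff e).symm
  obtain ⟨X, f, Y, f', Y', h₁, h₂, hff⟩ := exists_divergence hp.length_eq hne
  -- The common prefix contains `e₀`; its last edge `e` leads into the node of divergence.
  rcases List.eq_nil_or_concat X with rfl | ⟨X, e, rfl⟩
  · simp only [List.nil_append, List.cons.injEq] at h₁ h₂
    exact hff (h₁.1.symm.trans h₂.1)
  rw [h₁] at ht'
  rw [h₂] at ht
  have rot : ∀ {f Y}, IsTour G ((X ++ [e]) ++ f :: Y) → IsTour G (f :: Y ++ X ++ [e]) := by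
    intro f Y h
    simpa using h.swap
  have start : ∀ {f Y}, IsTour G ((X ++ [e]) ++ f :: Y) → G.Adj e.2 f.2 := by
    intro f Y h
    obtain ⟨a, ha⟩ := h.closed
    rw [List.append_assoc, edgeWalk_append] at ha
    obtain ⟨b, -, -, ha⟩ := ha
    have hf : G.Adj f.1 f.2 := (h.mem_iff f).1 (by simp)
    have h1 : f.1 = e.2 := ha.1
    rwa [h1] at hf
  have first : ∀ {f Y}, IsTour G ((X ++ [e]) ++ f :: Y) → f.1 = e.2 := by
    intro f Y h
    obtain ⟨a, ha⟩ := h.closed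
    rw [List.append_assoc, edgeWalk_append] at ha
    obtain ⟨b, -, -, ha⟩ := ha
    exact ha.1
  simp only [List.concat_eq_append] at ht ht'
  have hmem : e.2 ∈ A G := hA ▸ Set.mem_univ _
  rcases hmem with h1 | ⟨h2, hcut⟩
  · obtain ⟨z, hz⟩ := Set.ncard_eq_one.1 h1
    have m1 : f.2 ∈ {w | G.Adj e.2 w} := start ht'
    have m2 : f'.2 ∈ {w | G.Adj e.2 w} := start ht
    rw [hz] at m1 m2
    exact hff (Prod.ext ((first ht').trans (first ht).symm) (m1.trans m2.symm))
  · rw [isCutNode_iff] at hcut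
    refine hcut ⟨⟨f.2, ?_⟩,
      connOn_compl_of_divergence hl (rot ht') (rot ht) hff rfl h2 hout⟩
    intro h
    have := start ht'
    rw [Set.mem_singleton_iff.1 h] at this
    exact hl _ this

theorem hasUniqueEulerianCircuit_iff_A [Finite V] (G : Digraph V) (hl : Loopless G)
    (hc : WeaklyConnected G) (hE : (edgeSet G).Nonempty) (he : IsEulerian G) :
    HasUniqueEulerianCircuit G ↔ A G = Set.univ := by
  obtain ⟨L₀, h₀⟩ := (isEulerian_iff G).1 he
  have hout := h₀.exists_out hl hc hE
  rw [hasUniqueEulerianCircuit_iff]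
  constructor
  · rintro ⟨L, h, hu⟩
    refine Set.eq_univ_of_forall fun v => ?_
    have h2 := outDeg_le_two_of_unique h hu v
    have h1 : 0 < outDeg G v := (Set.ncard_pos).2 (hout v)
    rcases (by omega : outDeg G v = 1 ∨ outDeg G v = 2) with h | h'
    · exact Or.inl h
    · exact Or.inr ⟨h', isCutNode_of_unique hl h hu h'⟩
  · exact fun hA => ⟨L₀, h₀, fun L' h' => isRotated_of_forall_mem_A hl hE hout hA h₀ h'⟩

end Tours

/-! ### Connectivity under contraction and deletion of a node -/

section Contraction

variable {V : Type*}

theorem connOn_insert_loop (E : Set (V × V)) (S : Set V) (u : V) :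
    ConnOn (insert (u, u) E) S ↔ ConnOn E S := by
  constructor
  · intro h c hc
    refine h c fun p q hpq hp hq => ?_
    rcases hpq with hpq | hpq
    · obtain ⟨rfl, rfl⟩ := Prod.mk.inj hpq
      exact Iff.rfl
    · exact hc p q hpq hp hq
  · exact fun h c hc => h c fun p q hpq => hc p q (Or.inr hpq)

/-- Contracting a node `v` with one ingoing edge `(u, v)` and one outgoing edge `(v, w)`. -/
theorem connOn_contract {E : Set (V × V)} {S : Set V} {u v w : V} (huv : u ≠ v) (hwv : w ≠ v)
    (hE : ∀ e ∈ E, e.1 ≠ v ∧ e.2 ≠ v) (hv : v ∈ S) (huw : u ∈ S ∨ w ∈ S) :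
    ConnOn (insert (u, v) (insert (v, w) E)) S ↔ ConnOn (insert (u, w) E) (S \ {v}) := by
  classical
  constructor
  · intro h c hc a ha b hb
    -- A colouring of the contracted graph extends to `v` by the colour of a neighbour lying in `S`.
    have key := h (fun y => if y = v then (if u ∈ S then c u else c w) else c y) (by
      intro p q hpq hp hq
      rcases hpq with hpq | hpq | hpq
      · obtain ⟨rfl, rfl⟩ := Prod.mk.inj hpq
        simp [hp, huv]
      · obtain ⟨rfl, rfl⟩ := Prod.mk.inj hpq
        by_cases hu : u ∈ S
        · simpa [hu, hwv] using hc u q (Or.inl rfl) ⟨hu, huv⟩ ⟨hq, hwv⟩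
        · simp [hu, hwv]
      · obtain ⟨h1, h2⟩ := hE _ hpq
        simp only at h1 h2
        simpa [h1, h2] using hc p q (Or.inr hpq) ⟨hp, h1⟩ ⟨hq, h2⟩) a ha.1 b hb.1
    have hav : a ≠ v := ha.2
    have hbv : b ≠ v := hb.2
    simpa [hav, hbv] using key
  · intro h c hc
    have h1 : u ∈ S → (c u ↔ c v) := fun hu => hc u v (Or.inl rfl) hu hv
    have h2 : w ∈ S → (c v ↔ c w) := fun hw => hc v w (Or.inr (Or.inl rfl)) hv hw
    have key := h c (by
      intro p q hpq hp hq
      rcases hpq with hpq | hpq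
      · obtain ⟨rfl, rfl⟩ := Prod.mk.inj hpq
        exact (h1 hp.1).trans (h2 hq.1)
      · exact hc p q (Or.inr (Or.inr hpq)) hp.1 hq.1)
    obtain ⟨z, hz, hzv⟩ : ∃ z ∈ S \ {v}, (c z ↔ c v) := by
      rcases huw with hu | hw
      · exact ⟨u, ⟨hu, huv⟩, h1 hu⟩
      · exact ⟨w, ⟨hw, hwv⟩, (h2 hw).symm⟩
    have all : ∀ a ∈ S, (c a ↔ c v) := by
      intro a ha
      by_cases hav : a = v
      · rw [hav]
      · exact (key a ⟨ha, hav⟩ z hz).trans hzv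
    exact fun a ha b hb => (all a ha).trans (all b hb).symm

/-- A connected graph with at least two nodes has a node that is not a cut node. -/
theorem ConnOn.exists_diff_singleton {E : Set (V × V)} {S : Set V} (h : ConnOn E S)
    (hf : S.Finite) (hn : S.Nontrivial) : ∃ v ∈ S, ConnOn E (S \ {v}) := by
  have : Finite S := hf
  have : Nontrivial S := hn.coe_sort
  let E' : Set (S × S) := {e | (e.1.1, e.2.1) ∈ E}
  have hconn : (SimpleGraph.fromRel fun a b => (a, b) ∈ E').Connected := by
    refine (connected_fromRel_iff E').2 ⟨inferInstance, fun c hc a _ b _ => ?_⟩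
    have := h (fun y => ∃ hy : y ∈ S, c ⟨y, hy⟩) (fun p q hpq hp hq => by
      simpa [hp, hq] using hc ⟨p, hp⟩ ⟨q, hq⟩ hpq trivial trivial) a a.2 b b.2
    simpa using this
  obtain ⟨v, hv⟩ := hconn.exists_connected_induce_compl_singleton_of_finite_nontrivial
  have hv := ((connected_induce_fromRel_iff E' _).1 hv).2
  refine ⟨v, v.2, fun c hc a ha b hb => ?_⟩
  refine hv (fun y => c y) (fun p q hpq hp hq => ?_) ⟨a, ha.1⟩ ?_ ⟨b, hb.1⟩ ?_
  · exact hc p q hpq ⟨p.2, fun h => hp (Subtype.ext h)⟩ ⟨q.2, fun h => hq (Subtype.ext h)⟩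
  · exact fun h => ha.2 (congrArg Subtype.val h)
  · exact fun h => hb.2 (congrArg Subtype.val h)

end Contraction

section Multigraph

/-! ### Multigraphs on the natural numbers, as multisets of edges -/

/-- Contractions may create parallel edges, so edges are counted with multiplicity. -/
def outD (M : Multiset (ℕ × ℕ)) (v : ℕ) : ℕ := (M.map fun e => if e.1 = v then 1 else 0).sum

def inD (M : Multiset (ℕ × ℕ)) (v : ℕ) : ℕ := (M.map fun e => if e.2 = v then 1 else 0).sum

/-- The sum of the out-neighbours of `v`. -/
def outSum (M : Multiset (ℕ × ℕ)) (v : ℕ) : ℕ := (M.map fun e => if e.1 = v then e.2 else 0).sum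

/-- The sum of the in-neighbours of `v`. -/
def inSum (M : Multiset (ℕ × ℕ)) (v : ℕ) : ℕ := (M.map fun e => if e.2 = v then e.1 else 0).sum

@[simp] theorem outD_cons (e : ℕ × ℕ) (M : Multiset (ℕ × ℕ)) (v : ℕ) :
    outD (e ::ₘ M) v = (if e.1 = v then 1 else 0) + outD M v := by simp [outD]

@[simp] theorem inD_cons (e : ℕ × ℕ) (M : Multiset (ℕ × ℕ)) (v : ℕ) :
    inD (e ::ₘ M) v = (if e.2 = v then 1 else 0) + inD M v := by simp [inD]

@[simp] theorem outSum_cons (e : ℕ × ℕ) (M : Multiset (ℕ × ℕ)) (v : ℕ) :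
    outSum (e ::ₘ M) v = (if e.1 = v then e.2 else 0) + outSum M v := by simp [outSum]

@[simp] theorem inSum_cons (e : ℕ × ℕ) (M : Multiset (ℕ × ℕ)) (v : ℕ) :
    inSum (e ::ₘ M) v = (if e.2 = v then e.1 else 0) + inSum M v := by simp [inSum]

@[simp] theorem outD_zero (v : ℕ) : outD 0 v = 0 := rfl
@[simp] theorem inD_zero (v : ℕ) : inD 0 v = 0 := rfl
@[simp] theorem outSum_zero (v : ℕ) : outSum 0 v = 0 := rfl
@[simp] theorem inSum_zero (v : ℕ) : inSum 0 v = 0 := rfl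

variable {M : Multiset (ℕ × ℕ)}

theorem outD_pos_of_mem {e : ℕ × ℕ} (h : e ∈ M) : 0 < outD M e.1 := by
  obtain ⟨M, rfl⟩ := Multiset.exists_cons_of_mem h
  simp

theorem inD_pos_of_mem {e : ℕ × ℕ} (h : e ∈ M) : 0 < inD M e.2 := by
  obtain ⟨M, rfl⟩ := Multiset.exists_cons_of_mem h
  simp

theorem exists_cons_of_outD_pos {v : ℕ} (h : 0 < outD M v) : ∃ w M', M = (v, w) ::ₘ M' := by
  induction M using Multiset.induction with
  | empty => simp at h
  | cons e M ih =>
    by_cases hev : e.1 = v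
    · exact ⟨e.2, M, by rw [← hev]⟩
    · obtain ⟨w, M', rfl⟩ := ih (by simpa [hev] using h)
      exact ⟨w, e ::ₘ M', Multiset.cons_swap _ _ _⟩

theorem exists_cons_of_inD_pos {v : ℕ} (h : 0 < inD M v) : ∃ u M', M = (u, v) ::ₘ M' := by
  induction M using Multiset.induction with
  | empty => simp at h
  | cons e M ih =>
    by_cases hev : e.2 = v
    · exact ⟨e.1, M, by rw [← hev]⟩
    · obtain ⟨u, M', rfl⟩ := ih (by simpa [hev] using h)
      exact ⟨u, e ::ₘ M', Multiset.cons_swap _ _ _⟩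

/-- The nodes that are the tail of some edge. -/
def alive (M : Multiset (ℕ × ℕ)) : Set ℕ := {v | 0 < outD M v}

/-- Loopless, balanced, of out-degree at most two, and connected apart from isolated nodes. -/
structure Admissible (M : Multiset (ℕ × ℕ)) : Prop where
  loopless : ∀ e ∈ M, e.1 ≠ e.2
  balanced : ∀ v, outD M v = inD M v
  le_two : ∀ v, outD M v ≤ 2
  conn : ConnOn {e | e ∈ M} (alive M)

/-- Every node has out-degree one, or is a cut node of out-degree two. -/
def AllCut (M : Multiset (ℕ × ℕ)) : Prop :=
  ∀ v ∈ alive M, outD M v = 1 ∨ (outD M v = 2 ∧ ¬ ConnOn {e | e ∈ M} (alive M \ {v}))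

/-- Balance supplies the ingoing edge; as there are no loops, it differs from the outgoing one. -/
theorem Admissible.exists_edges (h : Admissible M) {v : ℕ} (hv : outD M v = 1) :
    ∃ u w M', M = (u, v) ::ₘ (v, w) ::ₘ M' ∧ u ≠ v ∧ w ≠ v ∧ outD M' v = 0 ∧ inD M' v = 0 := by
  obtain ⟨w, M₁, rfl⟩ := exists_cons_of_outD_pos (M := M) (v := v) (by omega)
  have hwv : w ≠ v := fun hwv => h.loopless (v, w) (by simp) hwv.symm
  have hi : inD M₁ v = 1 := by simpa [hwv, hv] using (h.balanced v).symm
  obtain ⟨u, M', rfl⟩ := exists_cons_of_inD_pos (M := M₁) (v := v) (by omega)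
  have huv : u ≠ v := fun huv => h.loopless (u, v) (by simp) huv
  refine ⟨u, w, M', Multiset.cons_swap _ _ _, huv, hwv, ?_, ?_⟩
  · simpa [huv] using hv
  · simpa using hi

theorem notMem_of_degree_eq_zero {v : ℕ} (ho : outD M v = 0) (hi : inD M v = 0) :
    ∀ e ∈ M, e.1 ≠ v ∧ e.2 ≠ v := by
  intro e he
  constructor
  · rintro rfl; have := outD_pos_of_mem he; omega
  · rintro rfl; have := inD_pos_of_mem he; omega

theorem setOf_mem_cons (e : ℕ × ℕ) (M : Multiset (ℕ × ℕ)) :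
    {f | f ∈ e ::ₘ M} = insert e {f | f ∈ M} := by
  ext f; simp

/-! ### The two reductions at a node of out-degree one -/

section Reduce

variable {u v w : ℕ}

theorem alive_contract (huv : u ≠ v) (ho : outD M v = 0) :
    alive ((u, w) ::ₘ M) = alive ((u, v) ::ₘ (v, w) ::ₘ M) \ {v} := by
  ext x
  simp only [alive, outD_cons, Set.mem_ofPred_eq, Set.mem_sdiff, Set.mem_singleton_iff]
  by_cases hx : x = v
  · subst hx; simp [huv, ho]
  · simp [hx, Ne.symm hx]

theorem connOn_contract_multiset (huv : u ≠ v) (hwv : w ≠ v) (ho : outD M v = 0)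
    (hi : inD M v = 0) {S : Set ℕ} (hv : v ∈ S) (huw : u ∈ S ∨ w ∈ S) :
    ConnOn {e | e ∈ (u, v) ::ₘ (v, w) ::ₘ M} S ↔
      ConnOn {e | e ∈ (u, w) ::ₘ M} (S \ {v}) := by
  simp only [setOf_mem_cons]
  exact connOn_contract huv hwv (notMem_of_degree_eq_zero ho hi) hv huw

theorem alive_of_cons_cons (h : Admissible ((u, v) ::ₘ (v, w) ::ₘ M)) :
    u ∈ alive ((u, v) ::ₘ (v, w) ::ₘ M) ∧ v ∈ alive ((u, v) ::ₘ (v, w) ::ₘ M) ∧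
      w ∈ alive ((u, v) ::ₘ (v, w) ::ₘ M) := by
  refine ⟨outD_pos_of_mem (e := (u, v)) (by simp), outD_pos_of_mem (e := (v, w)) (by simp), ?_⟩
  have := inD_pos_of_mem (M := (u, v) ::ₘ (v, w) ::ₘ M) (e := (v, w)) (by simp)
  rwa [← h.balanced] at this

theorem Admissible.contract (h : Admissible ((u, v) ::ₘ (v, w) ::ₘ M)) (huv : u ≠ v) (hwv : w ≠ v)
    (ho : outD M v = 0) (hi : inD M v = 0) (huw : u ≠ w) : Admissible ((u, w) ::ₘ M) where
  loopless e he := by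
    rcases Multiset.mem_cons.1 he with rfl | he
    · exact huw
    · exact h.loopless e (by simp [he])
  balanced x := by
    have := h.balanced x
    simp only [outD_cons, inD_cons] at this ⊢
    omega
  le_two x := by
    have := h.le_two x
    simp only [outD_cons] at this ⊢
    omega
  conn := by
    obtain ⟨hu, hv, -⟩ := alive_of_cons_cons h
    rw [alive_contract huv ho]
    exact (connOn_contract_multiset huv hwv ho hi hv (Or.inl hu)).1 h.conn

/-- Contraction commutes with the deletion of any `x ≠ v`, and `v` itself qualifies by its degree.
Since `u ≠ w`, deleting `x` leaves `v` at least one neighbour. -/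
theorem allCut_contract (h : Admissible ((u, v) ::ₘ (v, w) ::ₘ M)) (huv : u ≠ v) (hwv : w ≠ v)
    (ho : outD M v = 0) (hi : inD M v = 0) (huw : u ≠ w) :
    AllCut ((u, v) ::ₘ (v, w) ::ₘ M) ↔ AllCut ((u, w) ::ₘ M) := by
  obtain ⟨hu, hv, hw⟩ := alive_of_cons_cons h
  have hcut : ∀ x, x ≠ v → (ConnOn {e | e ∈ (u, v) ::ₘ (v, w) ::ₘ M}
      (alive ((u, v) ::ₘ (v, w) ::ₘ M) \ {x}) ↔
      ConnOn {e | e ∈ (u, w) ::ₘ M} (alive ((u, w) ::ₘ M) \ {x})) := by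
    intro x hx
    rw [connOn_contract_multiset huv hwv ho hi (S := _ \ {x}) ⟨hv, Ne.symm hx⟩,
      alive_contract huv ho, Set.sdiff_sdiff_comm]
    by_cases hxu : u = x
    · exact Or.inr ⟨hw, fun h => huw (hxu.trans h.symm)⟩
    · exact Or.inl ⟨hu, hxu⟩
  have hdeg : ∀ x, x ≠ v → outD ((u, v) ::ₘ (v, w) ::ₘ M) x = outD ((u, w) ::ₘ M) x := by
    intro x hx
    simp [Ne.symm hx]
  constructor
  · intro H x hx
    rw [alive_contract huv ho] at hx
    have := H x hx.1
    rwa [hcut x hx.2, hdeg x hx.2] at this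
  · intro H x hx
    by_cases hxv : x = v
    · left
      subst hxv
      simp [huv, ho]
    · rw [hcut x hxv, hdeg x hxv]
      exact H x (by rw [alive_contract huv ho]; exact ⟨hx, hxv⟩)

/-- Otherwise `u` and `v` would form a component of their own, although `M` still has an edge. -/
theorem Admissible.outD_eq_one_of_cycle (h : Admissible ((u, v) ::ₘ (v, u) ::ₘ M)) (huv : u ≠ v)
    (ho : outD M v = 0) (hi : inD M v = 0) (hM : M ≠ 0) : outD M u = 1 := by
  have h2 := h.le_two u
  simp only [outD_cons, if_true, huv.symm, if_false] at h2
  by_contra hne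
  have ho' : outD M u = 0 := by omega
  have hi' : inD M u = 0 := by
    have := h.balanced u
    simp [huv.symm] at this
    omega
  obtain ⟨e, he⟩ := Multiset.exists_mem_of_ne_zero hM
  obtain ⟨hu, hv, -⟩ := alive_of_cons_cons h
  have hev := notMem_of_degree_eq_zero ho hi
  have heu := notMem_of_degree_eq_zero ho' hi'
  have := (h.conn (fun x => x = u ∨ x = v) (by
    intro p q hpq _ _
    rcases Multiset.mem_cons.1 hpq with hpq | hpq
    · obtain ⟨rfl, rfl⟩ := Prod.mk.inj hpq; simp
    rcases Multiset.mem_cons.1 hpq with hpq | hpq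
    · obtain ⟨rfl, rfl⟩ := Prod.mk.inj hpq; simp
    have h1 := hev _ hpq
    have h2 := heu _ hpq
    simp only at h1 h2
    simp [h1, h2]) u hu e.1 (outD_pos_of_mem (by simp [he]))).1 (Or.inl rfl)
  rcases this with h | h
  · exact (heu e he).1 h
  · exact (hev e he).1 h

theorem alive_cycle (huv : u ≠ v) (ho : outD M v = 0) (hu : 0 < outD M u) :
    alive M = alive ((u, v) ::ₘ (v, u) ::ₘ M) \ {v} := by
  ext x
  simp only [alive, outD_cons, Set.mem_ofPred_eq, Set.mem_sdiff, Set.mem_singleton_iff]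
  by_cases hx : x = v
  · subst hx; simp [huv, ho]
  · by_cases hxu : x = u
    · subst hxu; simp [hu, hx]
    · simp [hx, Ne.symm hx, Ne.symm hxu]

/-- Contracting `v` turns the 2-cycle into a loop at `u`, which does not affect connectivity. -/
theorem connOn_cycle (huv : u ≠ v) (ho : outD M v = 0) (hi : inD M v = 0) {S : Set ℕ} (hv : v ∈ S)
    (hu : u ∈ S) :
    ConnOn {e | e ∈ (u, v) ::ₘ (v, u) ::ₘ M} S ↔ ConnOn {e | e ∈ M} (S \ {v}) := by
  rw [connOn_contract_multiset huv huv ho hi hv (Or.inl hu), setOf_mem_cons, connOn_insert_loop]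

theorem Admissible.remove_cycle (h : Admissible ((u, v) ::ₘ (v, u) ::ₘ M)) (huv : u ≠ v)
    (ho : outD M v = 0) (hi : inD M v = 0) : Admissible M where
  loopless e he := h.loopless e (by simp [he])
  balanced x := by
    have := h.balanced x
    simp only [outD_cons, inD_cons] at this
    omega
  le_two x := by
    have := h.le_two x
    simp only [outD_cons] at this
    omega
  conn := by
    by_cases hM : M = 0
    · subst hM
      intro c _ a ha
      simp [alive] at ha
    · obtain ⟨hu, hv, -⟩ := alive_of_cons_cons h
      have h1 := h.outD_eq_one_of_cycle huv ho hi hM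
      rw [alive_cycle huv ho (by omega)]
      exact (connOn_cycle huv ho hi hv hu).1 h.conn

/-- For non-empty `M` only `u` needs care: its degree drops from two to one. It qualifies before the
removal as well, because deleting `u` isolates `v` from the rest. -/
theorem allCut_remove_cycle (h : Admissible ((u, v) ::ₘ (v, u) ::ₘ M)) (huv : u ≠ v)
    (ho : outD M v = 0) (hi : inD M v = 0) :
    AllCut ((u, v) ::ₘ (v, u) ::ₘ M) ↔ AllCut M := by
  obtain ⟨hu, hv, -⟩ := alive_of_cons_cons h
  by_cases hM : M = 0
  · subst hM
    refine iff_of_true (fun x hx => Or.inl ?_) (fun x hx => ?_)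
    · simp only [alive, Set.mem_ofPred_eq, outD_cons, outD_zero] at hx ⊢
      split_ifs at hx ⊢ with h1 h2
      all_goals omega
    · simp [alive] at hx
  have h1 := h.outD_eq_one_of_cycle huv ho hi hM
  have hal := alive_cycle huv ho (M := M) (u := u) (by omega)
  have hcut : ∀ x, x ≠ v → x ≠ u → (ConnOn {e | e ∈ (u, v) ::ₘ (v, u) ::ₘ M}
      (alive ((u, v) ::ₘ (v, u) ::ₘ M) \ {x}) ↔ ConnOn {e | e ∈ M} (alive M \ {x})) := by
    intro x hx hxu
    rw [connOn_cycle huv ho hi (S := _ \ {x}) ⟨hv, Ne.symm hx⟩ ⟨hu, Ne.symm hxu⟩, hal,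
      Set.sdiff_sdiff_comm]
  have hdeg : ∀ x, x ≠ v → x ≠ u → outD ((u, v) ::ₘ (v, u) ::ₘ M) x = outD M x := by
    intro x hx hxu
    simp [Ne.symm hx, Ne.symm hxu]
  constructor
  · intro H x hx
    by_cases hxu : x = u
    · exact Or.inl (hxu ▸ h1)
    · rw [hal] at hx
      have := H x hx.1
      rwa [hcut x hx.2 hxu, hdeg x hx.2 hxu] at this
  · intro H x hx
    by_cases hxv : x = v
    · left
      subst hxv
      simp [huv, ho]
    by_cases hxu : x = u
    · right
      subst hxu
      refine ⟨by simp [h1, Ne.symm huv], fun hc => ?_⟩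
      obtain ⟨y, M', rfl⟩ := exists_cons_of_outD_pos (M := M) (v := x) (by omega)
      have hyv : y ≠ v := (notMem_of_degree_eq_zero ho hi (x, y) (by simp)).2
      have hxy : x ≠ y := h.loopless (x, y) (by simp)
      have hy : 0 < outD ((x, v) ::ₘ (v, x) ::ₘ (x, y) ::ₘ M') y := by
        rw [h.balanced]
        exact inD_pos_of_mem (e := (x, y)) (by simp)
      refine hyv ((hc (fun z => z = v) ?_ v ⟨hv, Ne.symm huv⟩ y ⟨hy, Ne.symm hxy⟩).1 rfl)
      intro p q hpq hp hq
      rcases Multiset.mem_cons.1 hpq with hpq | hpq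
      · exact (hp.2 (Prod.mk.inj hpq).1).elim
      rcases Multiset.mem_cons.1 hpq with hpq | hpq
      · exact (hq.2 (Prod.mk.inj hpq).2).elim
      have := notMem_of_degree_eq_zero ho hi _ hpq
      simp only at this
      simp [this]
    · rw [hcut x hxv hxu, hdeg x hxv hxu]
      exact H x (by rw [hal]; exact ⟨hx, hxv⟩)

end Reduce

theorem alive_finite (M : Multiset (ℕ × ℕ)) : (alive M).Finite := by
  refine (M.toFinset.image Prod.fst).finite_toSet.subset fun v hv => ?_
  obtain ⟨w, M', rfl⟩ := exists_cons_of_outD_pos hv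
  simp

theorem allCut_zero : AllCut 0 := fun v hv => by simp [alive] at hv

/-- If nothing can be reduced, the property holds for the empty graph only. -/
theorem Admissible.allCut_iff_eq_zero (h : Admissible M) (h1 : ∀ v, outD M v ≠ 1) :
    AllCut M ↔ M = 0 := by
  refine ⟨fun H => ?_, fun h => h ▸ allCut_zero⟩
  by_contra hM
  obtain ⟨e, he⟩ := Multiset.exists_mem_of_ne_zero hM
  have h2 : e.2 ∈ alive M := by
    have := inD_pos_of_mem he
    rwa [← h.balanced] at this
  -- A non-cut node, whose out-degree is not one either, violates the condition.
  obtain ⟨v, hv, hc⟩ := h.conn.exists_diff_singleton (alive_finite M)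
    ⟨e.1, outD_pos_of_mem he, e.2, h2, h.loopless e he⟩
  rcases H v hv with h | h
  · exact h1 v h
  · exact h.2 hc

end Multigraph

/-! ### From digraphs to multigraphs -/

section Link

/-- The edges of a list as a multigraph on the natural numbers. -/
def toMultigraph {n : ℕ} (L : List (Fin n × Fin n)) : Multiset (ℕ × ℕ) :=
  Multiset.ofList (L.map fun e => ((e.1 : ℕ), (e.2 : ℕ)))

variable {n : ℕ} {L : List (Fin n × Fin n)}

@[simp] theorem toMultigraph_nil : toMultigraph ([] : List (Fin n × Fin n)) = 0 := rfl

@[simp] theorem toMultigraph_cons (e : Fin n × Fin n) :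
    toMultigraph (e :: L) = ((e.1 : ℕ), (e.2 : ℕ)) ::ₘ toMultigraph L := rfl

theorem mem_toMultigraph {e : ℕ × ℕ} :
    e ∈ toMultigraph L ↔ ∃ f ∈ L, ((f.1 : ℕ), (f.2 : ℕ)) = e := by
  simp [toMultigraph]

theorem mem_toMultigraph_val {a b : Fin n} :
    ((a : ℕ), (b : ℕ)) ∈ toMultigraph L ↔ (a, b) ∈ L := by
  rw [mem_toMultigraph]
  constructor
  · rintro ⟨⟨p, q⟩, hf, h⟩
    simp only [Prod.mk.injEq, Fin.val_inj] at h
    rwa [← h.1, ← h.2]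
  · exact fun h => ⟨_, h, rfl⟩

theorem lt_of_mem_toMultigraph {e : ℕ × ℕ} (h : e ∈ toMultigraph L) : e.1 < n ∧ e.2 < n := by
  obtain ⟨f, -, rfl⟩ := mem_toMultigraph.1 h
  exact ⟨f.1.2, f.2.2⟩

theorem outD_toMultigraph (v : Fin n) :
    outD (toMultigraph L) v = (L.filter fun e => e.1 = v).length := by
  induction L with
  | nil => simp
  | cons e L ih =>
    rw [toMultigraph_cons, outD_cons, ih]
    by_cases h : e.1 = v
    · simp [h, Nat.add_comm]
    · simp [h, Fin.val_inj]

variable {G : Digraph (Fin n)}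

theorem IsEdgeList.outD_eq (h : IsEdgeList G L) (v : Fin n) :
    outD (toMultigraph L) v = outDeg G v := by
  rw [outD_toMultigraph, outDeg, ← List.toFinset_card_of_nodup (h.1.filter _)]
  rw [← Set.ncard_coe_finset]
  refine Set.ncard_congr (fun e _ => e.2) ?_ ?_ ?_
  · intro e he
    simp only [List.coe_toFinset, List.mem_filter, decide_eq_true_eq, Set.mem_ofPred_eq] at he ⊢
    rw [← he.2]
    exact (h.2 e).1 he.1
  · intro e f he hf hef
    simp only [List.coe_toFinset, List.mem_filter, decide_eq_true_eq, Set.mem_ofPred_eq] at he hf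
    exact Prod.ext (he.2.trans hf.2.symm) hef
  · intro w hw
    refine ⟨(v, w), ?_, rfl⟩
    simpa using (h.2 (v, w)).2 hw

theorem IsEdgeList.length_eq (h : IsEdgeList G L) : (edgeSet G).ncard = L.length := by
  rw [← List.toFinset_card_of_nodup h.1, ← Set.ncard_coe_finset]
  congr 1
  ext e
  simp [h.2 e]

theorem IsEdgeList.connOn_iff (h : IsEdgeList G L) (S : Set (Fin n)) :
    ConnOn (edgeSet G) S ↔ ConnOn {e | e ∈ toMultigraph L} (Fin.val '' S) := by
  constructor
  · rintro H c hc _ ⟨a, ha, rfl⟩ _ ⟨b, hb, rfl⟩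
    refine H (fun x => c x) (fun p q hpq hp hq => ?_) a ha b hb
    exact hc p q (mem_toMultigraph_val.2 ((h.2 _).2 hpq)) ⟨p, hp, rfl⟩ ⟨q, hq, rfl⟩
  · intro H c hc a ha b hb
    have := H (fun x => ∃ y : Fin n, (y : ℕ) = x ∧ c y) (by
      rintro _ _ hpq ⟨p, hp, rfl⟩ ⟨q, hq, rfl⟩
      simpa [Fin.val_inj] using hc p q ((h.2 _).1 (mem_toMultigraph_val.1 hpq)) hp hq)
      a ⟨a, ha, rfl⟩ b ⟨b, hb, rfl⟩
    simpa [Fin.val_inj] using this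

/-- A walk leaves each node as often as it enters it, up to the contributions of its two ends. -/
theorem EdgeWalk.balanced {a b : Fin n} (h : EdgeWalk a L b) (v : ℕ) :
    outD (toMultigraph L) v + (if (b : ℕ) = v then 1 else 0) =
      inD (toMultigraph L) v + (if (a : ℕ) = v then 1 else 0) := by
  induction L generalizing a with
  | nil =>
    have : a = b := h
    simp [this]
  | cons e L ih =>
    obtain ⟨rfl, h⟩ := h
    have := ih h
    simp only [toMultigraph_cons, outD_cons, inD_cons]
    omega

theorem IsEdgeList.balanced (h : IsEdgeList G L) (he : IsEulerian G) (v : ℕ) :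
    outD (toMultigraph L) v = inD (toMultigraph L) v := by
  obtain ⟨T, ht⟩ := (isEulerian_iff G).1 he
  have hp : L.Perm T := (List.perm_ext_iff_of_nodup h.1 ht.nodup).2
    fun e => (h.2 e).trans (ht.mem_iff e).symm
  have : toMultigraph L = toMultigraph T := Multiset.coe_eq_coe.2 (hp.map _)
  rw [this]
  obtain ⟨a, ha⟩ := ht.closed
  simpa using ha.balanced v

theorem IsEdgeList.alive_eq (h : IsEdgeList G L) (hl : Loopless G) (hc : WeaklyConnected G)
    (hE : (edgeSet G).Nonempty) (he : IsEulerian G) :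
    alive (toMultigraph L) = Set.range (Fin.val : Fin n → ℕ) := by
  obtain ⟨T, ht⟩ := (isEulerian_iff G).1 he
  ext x
  constructor
  · intro hx
    obtain ⟨w, M', hM⟩ := exists_cons_of_outD_pos hx
    have := (lt_of_mem_toMultigraph (e := (x, w)) (L := L) (by rw [hM]; simp)).1
    exact ⟨⟨x, this⟩, rfl⟩
  · rintro ⟨v, rfl⟩
    obtain ⟨w, hw⟩ := ht.exists_out hl hc hE v
    exact outD_pos_of_mem (e := ((v : ℕ), (w : ℕ))) (mem_toMultigraph_val.2 ((h.2 _).2 hw))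

theorem IsEdgeList.admissible (h : IsEdgeList G L) (hl : Loopless G) (hc : WeaklyConnected G)
    (hE : (edgeSet G).Nonempty) (he : IsEulerian G) (h2 : ∀ v, outD (toMultigraph L) v ≤ 2) :
    Admissible (toMultigraph L) where
  loopless e hm := by
    obtain ⟨⟨a, b⟩, hf, rfl⟩ := mem_toMultigraph.1 hm
    intro hab
    simp only [Fin.val_inj] at hab
    have : G.Adj a b := (h.2 _).1 hf
    rw [hab] at this
    exact hl _ this
  balanced := h.balanced he
  le_two := h2
  conn := by
    rw [h.alive_eq hl hc hE he, ← Set.image_univ, ← h.connOn_iff]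
    exact ((weaklyConnected_iff G).1 hc).2

theorem IsEdgeList.A_eq_univ_iff (h : IsEdgeList G L) (hl : Loopless G) (hc : WeaklyConnected G)
    (hE : (edgeSet G).Nonempty) (he : IsEulerian G) :
    A G = Set.univ ↔ AllCut (toMultigraph L) := by
  have hal := h.alive_eq hl hc hE he
  have hcut : ∀ v : Fin n, IsCutNode (U G) v ↔
      ¬ ConnOn {e | e ∈ toMultigraph L} (alive (toMultigraph L) \ {(v : ℕ)}) := by
    intro v
    have himg : alive (toMultigraph L) \ {(v : ℕ)} = Fin.val '' ({v}ᶜ : Set (Fin n)) := by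
      rw [hal, Set.compl_eq_univ_sdiff, Set.image_sdiff Fin.val_injective]
      simp
    -- The empty graph counts as disconnected, so `v` must not be the only node; an edge that is not
    -- a loop ensures this.
    have hne : ({v}ᶜ : Set (Fin n)).Nonempty := by
      obtain ⟨⟨a, b⟩, hab⟩ := hE
      by_cases hav : a = v
      · refine ⟨b, fun hbv => hl v ?_⟩
        have hab : G.Adj a b := hab
        rw [Set.mem_singleton_iff] at hbv
        rwa [hav, hbv] at hab
      · exact ⟨a, hav⟩
    rw [isCutNode_iff, himg, ← h.connOn_iff]
    simp [hne]
  rw [Set.eq_univ_iff_forall, AllCut, hal, Set.forall_mem_range]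
  refine forall_congr' fun v => ?_
  rw [h.outD_eq, ← hal, ← hcut]
  rfl

end Link

/-! ### Total correctness rules with step counts -/

namespace RAM

/-- Started in `s`, the program `p` halts, and `Q` holds for the number of steps and the final
state. -/
def Halts (W : ℕ) (p : Program) (s : State) (Q : ℕ → State → Prop) : Prop :=
  ∃ t s', Exec W p s t s' ∧ Q t s'

variable {W : ℕ} {p q : Program} {c : Test} {s : State} {Q R : ℕ → State → Prop}

theorem Halts.mono (h : Halts W p s Q) (hQ : ∀ t s', Q t s' → R t s') : Halts W p s R := by
  obtain ⟨t, s', he, hq⟩ := h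
  exact ⟨t, s', he, hQ t s' hq⟩

theorem Halts.seq (hp : Halts W p s fun t s' => Halts W q s' fun t' s'' => Q (t + t') s'') :
    Halts W (.seq p q) s Q := by
  obtain ⟨t, s', he, t', s'', he', hq⟩ := hp
  exact ⟨_, _, .seq he he', hq⟩

theorem Halts.skip (h : Q 1 s) : Halts W .skip s Q := ⟨1, s, .skip s, h⟩

theorem Halts.ite (ht : c.Holds s → Halts W p s fun t s' => Q (t + 1) s')
    (hf : ¬ c.Holds s → Halts W q s fun t s' => Q (t + 1) s') : Halts W (.ite c p q) s Q := by
  by_cases hc : c.Holds s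
  · obtain ⟨t, s', he, hq⟩ := ht hc
    exact ⟨_, _, .ite_true hc he, hq⟩
  · obtain ⟨t, s', he, hq⟩ := hf hc
    exact ⟨_, _, .ite_false hc he, hq⟩

/-- Loops, with an invariant `I k` that pays for `k` further steps. -/
theorem Halts.loop {I : ℕ → State → Prop}
    (hI : ∀ k s, I k s → c.Holds s →
      Halts W p s fun t s' => ∃ k', I k' s' ∧ k' + t + 1 ≤ k) {k : ℕ} (h : I k s) :
    Halts W (.loop c p) s fun t s' => t ≤ k + 1 ∧ ¬ c.Holds s' ∧ ∃ k', I k' s' := by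
  induction k using Nat.strong_induction_on generalizing s with
  | _ k ih =>
    by_cases hc : c.Holds s
    · obtain ⟨t, s', he, k', hk', hle⟩ := hI k s h hc
      obtain ⟨t', s'', he', hle', hc', hI'⟩ := ih k' (by omega) hk'
      exact ⟨_, _, .loop_true hc he he', by omega, hc', hI'⟩
    · exact ⟨1, s, .loop_false hc, by omega, hc, k, h⟩

/-- A list of instructions as a program. -/
def block : List Instr → Program
  | [] => .skip
  | i :: l => .seq (.instr i) (block l)

def run : List Instr → State → State
  | [], s => s
  | i :: l, s => run l (i.next s)

/-- All values written by the instructions are below `W`. -/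
def Fits (W : ℕ) : List Instr → State → Prop
  | [], _ => True
  | i :: l, s => i.value s < W ∧ Fits W l (i.next s)

/-- The additional step is the final `skip`. -/
theorem Halts.block {l : List Instr} (hf : Fits W l s) (h : Q (l.length + 1) (run l s)) :
    Halts W (block l) s Q := by
  induction l generalizing s Q with
  | nil => exact .skip h
  | cons i l ih =>
    refine .seq ⟨1, i.next s, .instr i s hf.1, ih hf.2 ?_⟩
    rwa [List.length_cons, Nat.add_comm] at h

end RAM

open RAM

/-! ### The reduction program -/

section Program

/-! Registers: `0` the answer, `1` and `2` the constants `1` and `2`, `3` the number of nodes,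
`4` the number of remaining edges, `5`, `6`, `7` the addresses of the arrays of out-degrees, of sums
of out-neighbours and of sums of in-neighbours, `8` a pointer into the list of edges, `9` zero,
`14` and `15` the index and the current node of the main loop, `16` a flag for out-degrees above
two; the others are temporary. -/

/-- The input takes `2m + 2` cells for `m` edges, and three arrays of length `n` follow. Register
`5` is thus both the base of the first array and the end of the edge list, which starts at address
`2`. -/
def initBlock : List Instr :=
  [.const 1 1, .const 2 2, .load 3 9, .load 4 1, .add 5 4 4, .add 5 5 2, .add 6 5 3, .add 7 6 3,
    .copy 8 2]

def degreeBlock : List Instr :=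
  [.load 10 8, .add 12 5 10, .load 13 12, .add 13 13 1, .store 12 13, .add 8 8 2]

def degreeLoop : Program :=
  .loop (.lt 8 5) (.seq (block degreeBlock) (.ite (.lt 2 13) (block [.const 16 1]) .skip))

def sumBlock : List Instr :=
  [.load 10 8, .add 12 8 1, .load 11 12, .add 12 6 10, .load 13 12, .add 13 13 11, .store 12 13,
    .add 12 7 11, .load 13 12, .add 13 13 10, .store 12 13, .add 8 8 2]

def sumLoop : Program := .loop (.lt 8 5) (block sumBlock)

def probeBlock : List Instr := [.add 12 5 15, .load 13 12]

/-- Register `12` still holds the degree address from `probeBlock`. As the degree was one, the two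
sums are the successor (`11`) and the predecessor (`10`). -/
def neighbourBlock : List Instr :=
  [.store 12 9, .add 12 6 15, .load 11 12, .add 12 7 15, .load 10 12]

def cycleBlock : List Instr :=
  [.add 12 5 10, .load 13 12, .sub 13 13 1, .store 12 13,
    .add 12 6 10, .load 13 12, .sub 13 13 15, .store 12 13,
    .add 12 7 10, .load 13 12, .sub 13 13 15, .store 12 13,
    .sub 4 4 2, .copy 15 10]

/-- In the sums at its two neighbours the contracted node is replaced by the other neighbour; their
degrees stay the same. -/
def contractBlock : List Instr :=
  [.add 12 6 10, .load 13 12, .add 13 13 11, .sub 13 13 15, .store 12 13,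
    .add 12 7 11, .load 13 12, .add 13 13 10, .sub 13 13 15, .store 12 13,
    .sub 4 4 1, .copy 15 10]

def advanceBlock : List Instr := [.add 14 14 1, .copy 15 14]

def reduceLoop : Program :=
  .loop (.lt 14 3) (.seq (block probeBlock)
    (.ite (.eq 13 1)
      (.seq (block neighbourBlock)
        (.ite (.eq 10 11) (block cycleBlock) (block contractBlock)))
      (block advanceBlock)))

/-- The sums are formed only once all degrees are known to be at most two; this bounds them by `2n`
and keeps the words linear. -/
def decideUnique : Program :=
  .seq (block initBlock) (.seq degreeLoop (.ite (.eq 16 9)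
    (.seq (block [.copy 8 2]) (.seq sumLoop (.seq reduceLoop
      (.ite (.eq 4 9) (block [.const 0 1]) .skip))))
    .skip))

end Program

/-! ### Invariants and cost of the three loops -/

section Correctness

theorem outSum_le {M : Multiset (ℕ × ℕ)} {n : ℕ} (h : ∀ e ∈ M, e.1 < n ∧ e.2 < n) (v : ℕ) :
    outSum M v ≤ n * outD M v := by
  induction M using Multiset.induction with
  | empty => simp
  | cons e M ih =>
    have h1 := h e (by simp)
    have h2 := ih fun f hf => h f (by simp [hf])
    simp only [outSum_cons, outD_cons, Nat.mul_add]
    split_ifs <;> omega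

theorem inSum_le {M : Multiset (ℕ × ℕ)} {n : ℕ} (h : ∀ e ∈ M, e.1 < n ∧ e.2 < n) (v : ℕ) :
    inSum M v ≤ n * inD M v := by
  induction M using Multiset.induction with
  | empty => simp
  | cons e M ih =>
    have h1 := h e (by simp)
    have h2 := ih fun f hf => h f (by simp [hf])
    simp only [inSum_cons, inD_cons, Nat.mul_add]
    split_ifs <;> omega

theorem outD_le_card (M : Multiset (ℕ × ℕ)) (v : ℕ) : outD M v ≤ M.card := by
  induction M using Multiset.induction with
  | empty => simp
  | cons e M ih =>
    simp only [outD_cons, Multiset.card_cons]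
    split_ifs <;> omega

/-- The values of the registers that hold constants. -/
structure Frame (n m : ℕ) (s : State) : Prop where
  r0 : s.reg 0 = 0
  r1 : s.reg 1 = 1
  r2 : s.reg 2 = 2
  r3 : s.reg 3 = n
  r5 : s.reg 5 = 2 * m + 2
  r6 : s.reg 6 = 2 * m + 2 + n
  r7 : s.reg 7 = 2 * m + 2 + n + n
  r9 : s.reg 9 = 0

theorem Frame.congr {n m : ℕ} {s s' : State} (h : Frame n m s)
    (hr : ∀ r < 10, r ≠ 4 → r ≠ 8 → s'.reg r = s.reg r) : Frame n m s' where
  r0 := by rw [hr 0 (by decide) (by decide) (by decide), h.r0]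
  r1 := by rw [hr 1 (by decide) (by decide) (by decide), h.r1]
  r2 := by rw [hr 2 (by decide) (by decide) (by decide), h.r2]
  r3 := by rw [hr 3 (by decide) (by decide) (by decide), h.r3]
  r5 := by rw [hr 5 (by decide) (by decide) (by decide), h.r5]
  r6 := by rw [hr 6 (by decide) (by decide) (by decide), h.r6]
  r7 := by rw [hr 7 (by decide) (by decide) (by decide), h.r7]
  r9 := by rw [hr 9 (by decide) (by decide) (by decide), h.r9]

/-- The list `l` of edges is in the memory. -/
def HoldsInput (l : List (ℕ × ℕ)) (s : State) : Prop :=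
  ∀ j (h : j < l.length), s.mem (2 * j + 2) = l[j].1 ∧ s.mem (2 * j + 3) = l[j].2

theorem coe_take_succ {α : Type*} {l : List α} {j : ℕ} (h : j < l.length) :
    ((l.take (j + 1) : List α) : Multiset α) = l[j] ::ₘ ((l.take j : List α) : Multiset α) := by
  rw [List.take_succ_eq_append_getElem h, Multiset.cons_coe, Multiset.coe_eq_coe]
  exact List.perm_append_singleton _ _

variable {n m W : ℕ} {l : List (ℕ × ℕ)}

/-- The first `j` edges have been read; the potential `k` grants each remaining one `20` steps, more
than a round costs. -/
structure DegreeInv (n : ℕ) (l : List (ℕ × ℕ)) (k : ℕ) (s : State) : Prop where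
  frame : Frame n l.length s
  input : HoldsInput l s
  r4 : s.reg 4 = l.length
  r14 : s.reg 14 = 0
  r15 : s.reg 15 = 0
  pos : ∃ j ≤ l.length, k = 20 * (l.length - j) ∧ s.reg 8 = 2 * j + 2 ∧
    (∀ v < n, s.mem (2 * l.length + 2 + v) = outD (l.take j : List (ℕ × ℕ)) v) ∧
    (s.reg 16 = 0 ↔ ∀ v < n, outD (l.take j : List (ℕ × ℕ)) v ≤ 2)
  zero₁ : ∀ v < n, s.mem (2 * l.length + 2 + n + v) = 0
  zero₂ : ∀ v < n, s.mem (2 * l.length + 2 + n + n + v) = 0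

theorem degreeLoop_step (hl : ∀ e ∈ l, e.1 < n ∧ e.2 < n) (hW : 5 * l.length + 3 * n + 10 ≤ W)
    {k : ℕ} {s : State} (h : DegreeInv n l k s) (hc : (Test.lt 8 5).Holds s) :
    Halts W (.seq (block degreeBlock) (.ite (.lt 2 13) (block [.const 16 1]) .skip)) s
      fun t s' => ∃ k', DegreeInv n l k' s' ∧ k' + t + 1 ≤ k := by
  obtain ⟨hfr, hin, h4, h14, h15, ⟨j, hj, hk, h8, hd, hflag⟩, z₁, z₂⟩ := h
  obtain ⟨f0, f1, f2, f3, f5, f6, f7, f9⟩ := id hfr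
  simp only [Test.Holds, h8, f5] at hc
  have hjl : j < l.length := by omega
  obtain ⟨hu, -⟩ := hin j hjl
  obtain ⟨lu, -⟩ := hl l[j] (List.getElem_mem hjl)
  have htake : ∀ v, outD (l.take (j + 1) : List (ℕ × ℕ)) v =
      (if l[j].1 = v then 1 else 0) + outD (l.take j : List (ℕ × ℕ)) v := by
    intro v; rw [coe_take_succ hjl, outD_cons]
  generalize l[j].1 = u at hu lu htake
  have hdu := hd u lu
  have hle := outD_le_card (l.take j : List (ℕ × ℕ)) u
  rw [Multiset.coe_card, List.length_take] at hle
  refine .seq (.block ?_ ?_)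
  · simp [degreeBlock, Fits, Instr.value, Instr.next, h8, f5, f1, f2, hu, hdu]
    omega
  have e16 : (run degreeBlock s).reg 16 = s.reg 16 := by simp [degreeBlock, run, Instr.next]
  have e4 : (run degreeBlock s).reg 4 = s.reg 4 := by simp [degreeBlock, run, Instr.next]
  have e14 : (run degreeBlock s).reg 14 = s.reg 14 := by simp [degreeBlock, run, Instr.next]
  have e15 : (run degreeBlock s).reg 15 = s.reg 15 := by simp [degreeBlock, run, Instr.next]
  have e8 : (run degreeBlock s).reg 8 = 2 * (j + 1) + 2 := by
    simp [degreeBlock, run, Instr.next, Instr.value, h8, f2]; omega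
  have e13 : (run degreeBlock s).reg 13 = outD (l.take (j + 1) : List (ℕ × ℕ)) u := by
    simp [degreeBlock, run, Instr.next, Instr.value, h8, f1, f5, hu, hdu, htake, Nat.add_comm 1]
  have emem : (run degreeBlock s).mem = Function.update s.mem (2 * l.length + 2 + u)
      (outD (l.take (j + 1) : List (ℕ × ℕ)) u) := by
    simp [degreeBlock, run, Instr.next, Instr.value, h8, f1, f5, hu, hdu, htake, Nat.add_comm 1]
  have hfr' : Frame n l.length (run degreeBlock s) := hfr.congr fun r hr h4 h8 => by
    simp [degreeBlock, run, Instr.next, h8, show r ≠ 10 by omega,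
      show r ≠ 12 by omega, show r ≠ 13 by omega]
  generalize run degreeBlock s = s' at *
  have hin' : HoldsInput l s' := by
    intro i hi
    rw [emem, Function.update_of_ne (by omega), Function.update_of_ne (by omega)]
    exact hin i hi
  have hd' : ∀ v < n, s'.mem (2 * l.length + 2 + v) = outD (l.take (j + 1) : List (ℕ × ℕ)) v := by
    intro v hv
    rw [emem, Function.update_apply]
    split_ifs with huv
    · rw [show v = u by omega]
    · rw [hd v hv, htake, if_neg (by omega), Nat.zero_add]
  have z₁' : ∀ v < n, s'.mem (2 * l.length + 2 + n + v) = 0 := by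
    intro v hv
    rw [emem, Function.update_of_ne (by omega), z₁ v hv]
  have z₂' : ∀ v < n, s'.mem (2 * l.length + 2 + n + n + v) = 0 := by
    intro v hv
    rw [emem, Function.update_of_ne (by omega), z₂ v hv]
  refine .ite (fun hc => ?_) (fun hc => ?_)
  · simp only [Test.Holds, e13, hfr'.r2] at hc
    refine .block (by simp [Fits, Instr.value]; omega) ⟨20 * (l.length - (j + 1)),
      ⟨hfr'.congr fun r hr _ _ => ?_, hin', by simpa [run, Instr.next, e4] using h4,
        by simpa [run, Instr.next, e14] using h14, by simpa [run, Instr.next, e15] using h15,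
        ⟨j + 1, hjl, rfl, by simpa [run, Instr.next] using e8, hd', ?_⟩, z₁', z₂'⟩, ?_⟩
    · simp [run, Instr.next, show r ≠ 16 by omega]
    · simp only [run, Instr.next, Instr.value, Function.update_self, one_ne_zero, false_iff]
      intro h
      have := h u lu
      omega
    · simp [degreeBlock]; omega
  · simp only [Test.Holds, e13, hfr'.r2] at hc
    refine .skip ⟨20 * (l.length - (j + 1)),
      ⟨hfr', hin', e4.trans h4, e14.trans h14, e15.trans h15,
        ⟨j + 1, hjl, rfl, e8, hd', ?_⟩, z₁', z₂'⟩, ?_⟩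
    · rw [e16, hflag]
      constructor
      · intro h v hv
        by_cases huv : v = u
        · subst huv; omega
        · rw [htake, if_neg (Ne.symm huv), Nat.zero_add]; exact h v hv
      · intro h v hv
        have := h v hv
        rw [htake] at this
        omega
    · simp [degreeBlock]; omega

structure SumInv (n : ℕ) (l : List (ℕ × ℕ)) (k : ℕ) (s : State) : Prop where
  frame : Frame n l.length s
  input : HoldsInput l s
  r4 : s.reg 4 = l.length
  r14 : s.reg 14 = 0
  r15 : s.reg 15 = 0
  deg : ∀ v < n, s.mem (2 * l.length + 2 + v) = outD l v
  pos : ∃ j ≤ l.length, k = 20 * (l.length - j) ∧ s.reg 8 = 2 * j + 2 ∧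
    (∀ v < n, s.mem (2 * l.length + 2 + n + v) = outSum (l.take j : List (ℕ × ℕ)) v) ∧
    ∀ v < n, s.mem (2 * l.length + 2 + n + n + v) = inSum (l.take j : List (ℕ × ℕ)) v

theorem outD_mono {M M' : Multiset (ℕ × ℕ)} (h : M ≤ M') (v : ℕ) : outD M v ≤ outD M' v := by
  obtain ⟨N, rfl⟩ := Multiset.le_iff_exists_add.1 h
  simp [outD]

theorem inD_mono {M M' : Multiset (ℕ × ℕ)} (h : M ≤ M') (v : ℕ) : inD M v ≤ inD M' v := by
  obtain ⟨N, rfl⟩ := Multiset.le_iff_exists_add.1 h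
  simp [inD]

theorem sumLoop_step (hl : ∀ e ∈ l, e.1 < n ∧ e.2 < n) (hW : 5 * l.length + 3 * n + 10 ≤ W)
    (ho : ∀ v, outD l v ≤ 2) (hi : ∀ v, inD l v ≤ 2)
    {k : ℕ} {s : State} (h : SumInv n l k s) (hc : (Test.lt 8 5).Holds s) :
    Halts W (block sumBlock) s fun t s' => ∃ k', SumInv n l k' s' ∧ k' + t + 1 ≤ k := by
  obtain ⟨hfr, hin, h4, h14, h15, hdeg, j, hj, hk, h8, hs, ht⟩ := h
  obtain ⟨f0, f1, f2, f3, f5, f6, f7, f9⟩ := id hfr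
  simp only [Test.Holds, h8, f5] at hc
  have hjl : j < l.length := by omega
  obtain ⟨hu, hv⟩ := hin j hjl
  obtain ⟨lu, lv⟩ := hl l[j] (List.getElem_mem hjl)
  have htake : ∀ v, outSum (l.take (j + 1) : List (ℕ × ℕ)) v =
      (if l[j].1 = v then l[j].2 else 0) + outSum (l.take j : List (ℕ × ℕ)) v := by
    intro v; rw [coe_take_succ hjl, outSum_cons]
  have htake' : ∀ v, inSum (l.take (j + 1) : List (ℕ × ℕ)) v =
      (if l[j].2 = v then l[j].1 else 0) + inSum (l.take j : List (ℕ × ℕ)) v := by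
    intro v; rw [coe_take_succ hjl, inSum_cons]
  have hsub : ((l.take j : List (ℕ × ℕ)) : Multiset (ℕ × ℕ)) ≤ l :=
    Multiset.coe_le.2 (List.take_sublist j l).subperm
  have hlt : ∀ e ∈ ((l.take j : List (ℕ × ℕ)) : Multiset (ℕ × ℕ)), e.1 < n ∧ e.2 < n :=
    fun e he => hl e (Multiset.mem_of_le hsub he)
  -- With degrees at most two, a sum still fits into a word after one more neighbour is added.
  have hso : ∀ v, outSum (l.take j : List (ℕ × ℕ)) v ≤ n * 2 := fun v =>
    (outSum_le hlt v).trans (Nat.mul_le_mul_left n ((outD_mono hsub v).trans (ho v)))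
  have hsi : ∀ v, inSum (l.take j : List (ℕ × ℕ)) v ≤ n * 2 := fun v =>
    (inSum_le hlt v).trans (Nat.mul_le_mul_left n ((inD_mono hsub v).trans (hi v)))
  generalize l[j].1 = u at hu lu htake htake'
  generalize l[j].2 = w at hv lv htake htake'
  have hsu := hs u lu
  have htw := ht w lv
  have hne : 2 * l.length + 2 + n + n + w ≠ 2 * l.length + 2 + n + u := by omega
  have hou := hso u
  have hiw := hsi w
  have emem : (run sumBlock s).mem = Function.update (Function.update s.mem
      (2 * l.length + 2 + n + u) (outSum (l.take (j + 1) : List (ℕ × ℕ)) u))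
      (2 * l.length + 2 + n + n + w) (inSum (l.take (j + 1) : List (ℕ × ℕ)) w) := by
    simp [sumBlock, run, Instr.next, Instr.value, h8, f1, f6, f7, hu, hv, hsu, htw, htake, htake',
      Function.update_of_ne hne, Nat.add_comm w, Nat.add_comm u]
  refine .block ?_ ⟨20 * (l.length - (j + 1)), ⟨?_, ?_, ?_, ?_, ?_, ?_,
    ⟨j + 1, hjl, rfl, ?_, ?_, ?_⟩⟩, ?_⟩
  · simp [sumBlock, Fits, Instr.value, Instr.next, h8, f1, f2, f6, f7, hu, hv, hsu, htw,
      Function.update_of_ne hne]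
    omega
  · exact hfr.congr fun r hr h4 h8 => by
      simp [sumBlock, run, Instr.next, h8, show r ≠ 10 by omega,
        show r ≠ 11 by omega, show r ≠ 12 by omega, show r ≠ 13 by omega]
  · intro i hi
    rw [emem, Function.update_of_ne (by omega), Function.update_of_ne (by omega),
      Function.update_of_ne (by omega), Function.update_of_ne (by omega)]
    exact hin i hi
  · simpa [sumBlock, run, Instr.next] using h4
  · simpa [sumBlock, run, Instr.next] using h14
  · simpa [sumBlock, run, Instr.next] using h15
  · intro v hv
    rw [emem, Function.update_of_ne (by omega), Function.update_of_ne (by omega), hdeg v hv]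
  · simp [sumBlock, run, Instr.next, Instr.value, h8, f2]; omega
  · intro v hv
    rw [emem, Function.update_of_ne (by omega), Function.update_apply]
    split_ifs with huv
    · rw [show v = u by omega]
    · rw [hs v hv, htake, if_neg (by omega), Nat.zero_add]
  · intro v hv
    rw [emem, Function.update_apply]
    split_ifs with huv
    · rw [show v = w by omega]
    · rw [Function.update_of_ne (by omega), ht v hv, htake', if_neg (by omega), Nat.zero_add]
  · simp [sumBlock]; omega

/-- The multigraph `M` that is left over is in the memory, and no node up to the index of the main
loop other than the current one can be reduced. -/
structure ReduceInv (n m : ℕ) (P : Prop) (k : ℕ) (s : State) : Prop where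
  frame : Frame n m s
  graph : ∃ M, Admissible M ∧ (AllCut M ↔ P) ∧ (∀ e ∈ M, e.1 < n ∧ e.2 < n) ∧ M.card ≤ m ∧
    -- Every round removes an edge or advances the index, in fewer than `40` steps.
    k = 40 * (M.card + (n - s.reg 14)) ∧ s.reg 4 = M.card ∧ s.reg 14 ≤ n ∧
    (s.reg 14 < n → s.reg 15 < n) ∧ (s.reg 14 = n → s.reg 15 = n) ∧
    (∀ v ≤ s.reg 14, v ≠ s.reg 15 → outD M v ≠ 1) ∧
    (∀ v < n, s.mem (2 * m + 2 + v) = outD M v) ∧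
    -- The sums of removed nodes are not cleared, hence the restriction to positive degree.
    (∀ v < n, 0 < outD M v → s.mem (2 * m + 2 + n + v) = outSum M v) ∧
    ∀ v < n, 0 < outD M v → s.mem (2 * m + 2 + n + n + v) = inSum M v

theorem outSum_eq_zero {M : Multiset (ℕ × ℕ)} {v : ℕ} (h : outD M v = 0) : outSum M v = 0 := by
  induction M using Multiset.induction with
  | empty => simp
  | cons e M ih =>
    rw [outD_cons] at h
    rw [outSum_cons, ih (by omega)]
    split_ifs at h ⊢ <;> omega

theorem inSum_eq_zero {M : Multiset (ℕ × ℕ)} {v : ℕ} (h : inD M v = 0) : inSum M v = 0 := by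
  induction M using Multiset.induction with
  | empty => simp
  | cons e M ih =>
    rw [inD_cons] at h
    rw [inSum_cons, ih (by omega)]
    split_ifs at h ⊢ <;> omega

theorem reduceLoop_step {P : Prop} (hW : 5 * m + 3 * n + 10 ≤ W)
    {k : ℕ} {s : State} (h : ReduceInv n m P k s) (hc : (Test.lt 14 3).Holds s) :
    Halts W (.seq (block probeBlock)
      (.ite (.eq 13 1)
        (.seq (block neighbourBlock)
          (.ite (.eq 10 11) (block cycleBlock) (block contractBlock)))
        (block advanceBlock))) s
      fun t s' => ∃ k', ReduceInv n m P k' s' ∧ k' + t + 1 ≤ k := by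
  obtain ⟨hfr, M, hM, hP, hlt, hcard, hk, h4, h14, h15, -, hdone, hd, hs, ht⟩ := h
  obtain ⟨f0, f1, f2, f3, f5, f6, f7, f9⟩ := id hfr
  simp only [Test.Holds, f3] at hc
  have hxn := h15 hc
  generalize hi : s.reg 14 = i at *
  generalize hx : s.reg 15 = x at *
  have hdx := hd x hxn
  have h2 := hM.le_two x
  refine .seq (.block ?_ ?_)
  · simp [probeBlock, Fits, Instr.value, Instr.next, f5, hx, hdx]
    omega
  have e13 : (run probeBlock s).reg 13 = outD M x := by
    simp [probeBlock, run, Instr.next, Instr.value, f5, hx, hdx]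
  have e12 : (run probeBlock s).reg 12 = 2 * m + 2 + x := by
    simp [probeBlock, run, Instr.next, Instr.value, f5, hx]
  have e4 : (run probeBlock s).reg 4 = M.card := by simp [probeBlock, run, Instr.next, h4]
  have e14 : (run probeBlock s).reg 14 = i := by simp [probeBlock, run, Instr.next, hi]
  have e15 : (run probeBlock s).reg 15 = x := by simp [probeBlock, run, Instr.next, hx]
  have emem : (run probeBlock s).mem = s.mem := by simp [probeBlock, run, Instr.next]
  have hfr' : Frame n m (run probeBlock s) := hfr.congr fun r hr _ _ => by
    simp [probeBlock, run, Instr.next, show r ≠ 12 by omega,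
      show r ≠ 13 by omega]
  rw [← emem] at hd hs ht
  generalize run probeBlock s = s₁ at *
  clear f0 f1 f2 f3 f5 f6 f7 f9
  obtain ⟨f0, f1, f2, f3, f5, f6, f7, f9⟩ := id hfr'
  refine .ite (fun hc => ?_) (fun hc => ?_)
  · simp only [Test.Holds, e13, f1] at hc
    obtain ⟨u, w, M', rfl, huv, hwv, ho, hi'⟩ := hM.exists_edges hc
    have hul : u < n := (hlt (u, x) (by simp)).1
    have hwl : w < n := (hlt (x, w) (by simp)).2
    have hsx := hs x hxn (by omega)
    have htx := ht x hxn (by omega)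
    rw [outSum_cons, outSum_cons, if_neg huv, if_pos rfl, outSum_eq_zero ho] at hsx
    rw [inSum_cons, inSum_cons, if_pos rfl, if_neg hwv, inSum_eq_zero hi'] at htx
    simp only [Nat.add_zero, Nat.zero_add] at hsx htx
    obtain ⟨hua, -, hwa⟩ := alive_of_cons_cons hM
    have hdu := hd u hul
    have hsu := hs u hul hua
    have htu := ht u hul hua
    have htw := ht w hwl hwa
    have hdu2 := hM.le_two u
    have hsu2 := (outSum_le hlt u).trans (Nat.mul_le_mul_left n (hM.le_two u))
    have htw2 := (inSum_le hlt w).trans (Nat.mul_le_mul_left n (hM.balanced w ▸ hM.le_two w))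
    simp only [Multiset.card_cons] at hcard h4 e4 hk
    have n1 : 2 * m + 2 + n + x ≠ 2 * m + 2 + x := by omega
    have n2 : 2 * m + 2 + n + n + x ≠ 2 * m + 2 + x := by omega
    refine .seq (.block ?_ ?_)
    · simp [neighbourBlock, Fits, Instr.value, Instr.next, f6, f7, f9, e12, e15, hsx, htx,
        Function.update_of_ne n1, Function.update_of_ne n2]
      omega
    have b10 : (run neighbourBlock s₁).reg 10 = u := by
      simp [neighbourBlock, run, Instr.value, Instr.next, f6, f7, f9, e12, e15, hsx, htx,
        Function.update_of_ne n1, Function.update_of_ne n2]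
    have b11 : (run neighbourBlock s₁).reg 11 = w := by
      simp [neighbourBlock, run, Instr.value, Instr.next, f6, f7, f9, e12, e15, hsx, htx,
        Function.update_of_ne n1, Function.update_of_ne n2]
    have b4 : (run neighbourBlock s₁).reg 4 = M'.card + 1 + 1 := by
      simp [neighbourBlock, run, Instr.next, e4]
    have b14 : (run neighbourBlock s₁).reg 14 = i := by simp [neighbourBlock, run, Instr.next, e14]
    have b15 : (run neighbourBlock s₁).reg 15 = x := by simp [neighbourBlock, run, Instr.next, e15]
    have bmem : (run neighbourBlock s₁).mem = Function.update s₁.mem (2 * m + 2 + x) 0 := by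
      simp [neighbourBlock, run, Instr.value, Instr.next, f9, e12]
    have hfr₂ : Frame n m (run neighbourBlock s₁) := hfr'.congr fun r hr _ _ => by
      simp [neighbourBlock, run, Instr.next, show r ≠ 10 by omega, show r ≠ 11 by omega,
        show r ≠ 12 by omega]
    clear n1 n2
    generalize run neighbourBlock s₁ = s₂ at *
    clear f0 f1 f2 f3 f5 f6 f7 f9
    obtain ⟨f0, f1, f2, f3, f5, f6, f7, f9⟩ := id hfr₂
    have bdu : s₂.mem (2 * m + 2 + u) = s₁.mem (2 * m + 2 + u) := by
      rw [bmem, Function.update_of_ne (by omega)]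
    rw [hdu] at bdu
    have bsu : s₂.mem (2 * m + 2 + n + u) = s₁.mem (2 * m + 2 + n + u) := by
      rw [bmem, Function.update_of_ne (by omega)]
    rw [hsu] at bsu
    have btu : s₂.mem (2 * m + 2 + n + n + u) = s₁.mem (2 * m + 2 + n + n + u) := by
      rw [bmem, Function.update_of_ne (by omega)]
    rw [htu] at btu
    have btw : s₂.mem (2 * m + 2 + n + n + w) = s₁.mem (2 * m + 2 + n + n + w) := by
      rw [bmem, Function.update_of_ne (by omega)]
    rw [htw] at btw
    refine .ite (fun huw => ?_) (fun huw => ?_)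
    · simp only [Test.Holds, b10, b11] at huw
      subst huw
      have n1 : 2 * m + 2 + n + u ≠ 2 * m + 2 + u := by omega
      have n2 : 2 * m + 2 + n + n + u ≠ 2 * m + 2 + u := by omega
      have n3 : 2 * m + 2 + n + n + u ≠ 2 * m + 2 + n + u := by omega
      simp only [outD_cons, outSum_cons, inSum_cons, if_true, if_neg huv.symm,
        Nat.zero_add] at bdu bsu btu hdu2 hsu2 htw2
      have cmem : (run cycleBlock s₂).mem = Function.update (Function.update (Function.update s₂.mem
          (2 * m + 2 + u) (outD M' u)) (2 * m + 2 + n + u) (outSum M' u))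
          (2 * m + 2 + n + n + u) (inSum M' u) := by
        simp [cycleBlock, run, Instr.next, Instr.value, f1, f5, f6, f7, b10, b15, bdu, bsu, btu,
          Function.update_of_ne n1, Function.update_of_ne n2, Function.update_of_ne n3]
      have c14 : (run cycleBlock s₂).reg 14 = i := by simp [cycleBlock, run, Instr.next, b14]
      have c15 : (run cycleBlock s₂).reg 15 = u := by
        simp [cycleBlock, run, Instr.next, Instr.value, b10]
      refine .block ?_ ⟨40 * (M'.card + (n - i)), ⟨?_, M', hM.remove_cycle huv ho hi',
        (allCut_remove_cycle hM huv ho hi').symm.trans hP, ?_, by omega, ?_, ?_, ?_, ?_, ?_, ?_,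
        ?_, ?_, ?_⟩, ?_⟩
      · simp [cycleBlock, Fits, Instr.next, Instr.value, f1, f2, f5, f6, f7, b4, b10, b15, bdu, bsu,
          btu, Function.update_of_ne n1, Function.update_of_ne n2, Function.update_of_ne n3]
        omega
      · exact hfr₂.congr fun r hr h4 _ => by
          simp [cycleBlock, run, Instr.next, show r ≠ 12 by omega, show r ≠ 13 by omega,
            show r ≠ 15 by omega, h4]
      · exact fun e he => hlt e (by simp [he])
      · rw [c14]
      · simp [cycleBlock, run, Instr.next, Instr.value, b4, f2]
      · rw [c14]; exact h14
      · rw [c15]; exact fun _ => hul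
      · rw [c14]; omega
      -- Only `x` and `u` change their degrees: `x` drops to zero and `u` is the new current node.
      · rw [c14, c15]
        intro v hv hvu
        by_cases hvx : v = x
        · subst hvx; omega
        · simpa [Ne.symm hvu, Ne.symm hvx] using hdone v hv hvx
      · intro v hv
        rw [cmem, Function.update_of_ne (by omega), Function.update_of_ne (by omega),
          Function.update_apply, bmem, Function.update_apply]
        split_ifs with h₁ h₂
        · rw [show v = u by omega]
        · rw [show v = x by omega, ho]
        · rw [hd v hv, outD_cons, outD_cons, if_neg (by omega), if_neg (by omega), Nat.zero_add,
            Nat.zero_add]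
      · intro v hv hpos
        have hvx : v ≠ x := by rintro rfl; omega
        rw [cmem, Function.update_of_ne (by omega), Function.update_apply, bmem]
        split_ifs with h₁
        · rw [show v = u by omega]
        · rw [Function.update_of_ne (by omega), Function.update_of_ne (by omega), hs v hv (by
            rw [outD_cons, outD_cons]; omega), outSum_cons, outSum_cons, if_neg (by omega),
            if_neg (by omega), Nat.zero_add, Nat.zero_add]
      · intro v hv hpos
        have hvx : v ≠ x := by rintro rfl; omega
        rw [cmem, Function.update_apply, bmem]
        split_ifs with h₁
        · rw [show v = u by omega]
        · rw [Function.update_of_ne (by omega), Function.update_of_ne (by omega),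
            Function.update_of_ne (by omega), ht v hv (by
            rw [outD_cons, outD_cons]; omega), inSum_cons, inSum_cons, if_neg (by omega),
            if_neg (by omega), Nat.zero_add, Nat.zero_add]
      · simp [cycleBlock, neighbourBlock, probeBlock]; omega
    · simp only [Test.Holds, b10, b11] at huw
      have n1 : 2 * m + 2 + n + n + w ≠ 2 * m + 2 + n + u := by omega
      have su : outSum M' u + w = outSum ((u, w) ::ₘ M') u := by simp [Nat.add_comm]
      have sw : inSum M' w + u = inSum ((u, w) ::ₘ M') w := by simp [Nat.add_comm]
      simp only [outSum_cons, inSum_cons, if_true, if_neg huv.symm, if_neg hwv.symm,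
        Nat.zero_add] at bsu btw hsu2 htw2
      have cmem : (run contractBlock s₂).mem = Function.update (Function.update s₂.mem
          (2 * m + 2 + n + u) (outSum ((u, w) ::ₘ M') u))
          (2 * m + 2 + n + n + w) (inSum ((u, w) ::ₘ M') w) := by
        rw [← su, ← sw]
        simp [contractBlock, run, Instr.next, Instr.value, f6, f7, b10, b11, b15, bsu, btw,
          Function.update_of_ne n1, Nat.add_assoc x]
      have c14 : (run contractBlock s₂).reg 14 = i := by simp [contractBlock, run, Instr.next, b14]
      have c15 : (run contractBlock s₂).reg 15 = u := by
        simp [contractBlock, run, Instr.next, Instr.value, b10]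
      refine .block ?_ ⟨40 * (((u, w) ::ₘ M').card + (n - i)), ⟨?_, (u, w) ::ₘ M',
        hM.contract huv hwv ho hi' huw, (allCut_contract hM huv hwv ho hi' huw).symm.trans hP, ?_,
        by simp; omega, ?_, ?_, ?_, ?_, ?_, ?_, ?_, ?_, ?_⟩, ?_⟩
      · simp [contractBlock, Fits, Instr.next, Instr.value, f1, f6, f7, b4, b10, b11, b15, bsu, btw,
          Function.update_of_ne n1]
        omega
      · exact hfr₂.congr fun r hr h4 _ => by
          simp [contractBlock, run, Instr.next, show r ≠ 12 by omega, show r ≠ 13 by omega,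
            show r ≠ 15 by omega, h4]
      · intro e he
        rcases Multiset.mem_cons.1 he with rfl | he
        · exact ⟨hul, hwl⟩
        · exact hlt e (by simp [he])
      · rw [c14]
      · simp [contractBlock, run, Instr.next, Instr.value, b4, f1]
      · rw [c14]; exact h14
      · rw [c15]; exact fun _ => hul
      · rw [c14]; omega
      · rw [c14, c15]
        intro v hv hvu
        by_cases hvx : v = x
        · subst hvx; simp [huv, ho]
        · simpa [Ne.symm hvu, Ne.symm hvx] using hdone v hv hvx
      · intro v hv
        rw [cmem, Function.update_of_ne (by omega), Function.update_of_ne (by omega),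
          bmem, Function.update_apply]
        split_ifs with h₁
        · rw [show v = x by omega, outD_cons, if_neg huv, ho]
        · rw [hd v hv, outD_cons, outD_cons, outD_cons, if_neg (show x ≠ v by omega), Nat.zero_add]
      · intro v hv hpos
        have hvx : v ≠ x := by rintro rfl; simp [huv, ho] at hpos
        rw [cmem, Function.update_of_ne (by omega), Function.update_apply, bmem]
        split_ifs with h₁
        · rw [show v = u by omega]
        · rw [Function.update_of_ne (by omega), hs v hv (by
            simpa [Ne.symm hvx] using hpos), outSum_cons, outSum_cons,
            outSum_cons, if_neg (show u ≠ v by omega), if_neg (show x ≠ v by omega),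
            if_neg (show u ≠ v by omega), Nat.zero_add]
      · intro v hv hpos
        have hvx : v ≠ x := by rintro rfl; simp [huv, ho] at hpos
        rw [cmem, Function.update_apply, bmem]
        split_ifs with h₁
        · rw [show v = w by omega]
        · rw [Function.update_of_ne (by omega), Function.update_of_ne (by omega), ht v hv (by
            simpa [Ne.symm hvx] using hpos), inSum_cons, inSum_cons,
            inSum_cons, if_neg (show x ≠ v by omega), if_neg (show w ≠ v by omega),
            if_neg (show w ≠ v by omega), Nat.zero_add]
      · simp [contractBlock, neighbourBlock, probeBlock]; omega
  · simp only [Test.Holds, e13, f1] at hc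
    refine .block ?_ ⟨40 * (M.card + (n - (i + 1))), ⟨?_, M, hM, hP, hlt, hcard, ?_, ?_, ?_, ?_,
      ?_, ?_, hd, hs, ht⟩, ?_⟩
    · simp [advanceBlock, Fits, Instr.value, Instr.next, e14, f1]; omega
    · exact hfr'.congr fun r hr _ _ => by
        simp [advanceBlock, run, Instr.next, show r ≠ 14 by omega,
          show r ≠ 15 by omega]
    · simp [advanceBlock, run, Instr.next, Instr.value, e14, f1]
    · simpa [advanceBlock, run, Instr.next] using e4
    · simp [advanceBlock, run, Instr.next, Instr.value, e14, f1]; omega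
    · simp [advanceBlock, run, Instr.next, Instr.value, e14, f1]
    · simp [advanceBlock, run, Instr.next, Instr.value, e14, f1]
    · simp only [advanceBlock, run, Instr.next, Instr.value, e14, f1, Function.update_self]
      intro v hv hne
      by_cases hvx : v = x
      · rwa [hvx]
      · exact hdone v (by simp at hv hne; omega) hvx
    · simp [advanceBlock, probeBlock]; omega

end Correctness

/-! ### Reading the input, and the total cost -/

section Input

variable {n : ℕ} {L : List (Fin n × Fin n)}

theorem getD_flatMap_pair (L : List (Fin n × Fin n)) (j : ℕ) (h : j < L.length) :
    (L.flatMap fun e => [(e.1 : ℕ), (e.2 : ℕ)]).getD (2 * j) 0 = L[j].1 ∧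
      (L.flatMap fun e => [(e.1 : ℕ), (e.2 : ℕ)]).getD (2 * j + 1) 0 = L[j].2 := by
  induction L generalizing j with
  | nil => simp at h
  | cons e L ih =>
    cases j with
    | zero => simp
    | succ j =>
      have := ih j (by simpa using h)
      simpa [Nat.mul_add] using this

theorem holdsInput_initState (L : List (Fin n × Fin n)) :
    HoldsInput (L.map fun e => ((e.1 : ℕ), (e.2 : ℕ))) (initState n L) := by
  intro j hj
  simpa [initState, inputWords] using getD_flatMap_pair L j (by simpa using hj)

theorem initState_mem_eq_zero (L : List (Fin n × Fin n)) (a : ℕ) :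
    (initState n L).mem (2 * L.length + 2 + a) = 0 := by
  refine List.getD_eq_default _ _ ?_
  simp [inputWords, List.length_flatMap]
  omega

/-- Choosing an out-edge at each node injects nodes into edges; this turns bounds in `n` into bounds
in the number of edges. -/
theorem IsEdgeList.le_length {G : Digraph (Fin n)} (h : IsEdgeList G L)
    (hout : ∀ v, ∃ w, G.Adj v w) : n ≤ L.length := by
  choose f hf using hout
  have hsub : (List.finRange n).map (fun v => (v, f v)) ⊆ L := by
    intro e he
    obtain ⟨v, -, rfl⟩ := List.mem_map.1 he
    exact (h.2 _).2 (hf v)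
  have hnd : ((List.finRange n).map (fun v => (v, f v))).Nodup :=
    (List.nodup_finRange n).map fun a b hab => (Prod.mk.inj hab).1
  simpa using (hnd.subperm hsub).length_le

end Input

/-- With `m` edges and `1 ≤ n ≤ m`, the loops cost at most `20m + 20m + 80m` up to a constant, and
words need `5m + 3n + 10 ≤ 18m`; the factor `200` covers both. -/
theorem decideUnique_halts {n : ℕ} {G : Digraph (Fin n)} {L : List (Fin n × Fin n)}
    (hl : Loopless G) (hc : WeaklyConnected G) (hE : (edgeSet G).Nonempty) (he : IsEulerian G)
    (h : IsEdgeList G L) :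
    Halts (200 * L.length) decideUnique (initState n L) fun t s =>
      t ≤ 200 * L.length ∧ (A G = Set.univ → s.reg 0 = 1) ∧ (A G ≠ Set.univ → s.reg 0 = 0) := by
  have hnm : n ≤ L.length := by
    obtain ⟨T, ht⟩ := (isEulerian_iff G).1 he
    exact h.le_length (ht.exists_out hl hc hE)
  have hn : 0 < n := by
    obtain ⟨e, -⟩ := hE
    exact e.1.pos
  rw [ne_eq, h.A_eq_univ_iff hl hc hE he]
  have hbal := h.balanced he
  have hadm := h.admissible hl hc hE he
  have hlt : ∀ e ∈ L.map (fun e => ((e.1 : ℕ), (e.2 : ℕ))), e.1 < n ∧ e.2 < n :=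
    fun e he => lt_of_mem_toMultigraph (L := L) he
  have hin := holdsInput_initState L
  have hzero := initState_mem_eq_zero L
  have hlen : (L.map (fun e => ((e.1 : ℕ), (e.2 : ℕ)))).length = L.length := by simp
  have hm0 : (initState n L).mem 0 = n := rfl
  have hm1 : (initState n L).mem 1 = L.length := rfl
  have hreg : ∀ r, (initState n L).reg r = 0 := fun _ => rfl
  unfold toMultigraph at *
  clear h
  generalize initState n L = s at *
  generalize L.map (fun e => ((e.1 : ℕ), (e.2 : ℕ))) = l at *
  generalize L.length = m at *
  subst hlen
  refine .seq (.block ?_ ?_)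
  · simp [initBlock, Fits, Instr.next, Instr.value, hreg, hm0, hm1]
    omega
  have hinv : DegreeInv n l (20 * (l.length - 0)) (run initBlock s) := by
    refine ⟨⟨?_, ?_, ?_, ?_, ?_, ?_, ?_, ?_⟩, hin, ?_, ?_, ?_, ⟨0, by omega, rfl, ?_, ?_, ?_⟩, ?_, ?_⟩
    all_goals simp [initBlock, run, Instr.next, Instr.value, hreg, hm0, hm1]
    all_goals try omega
    · exact fun v _ => hzero v
    · intro v _
      rw [Nat.add_assoc]; exact hzero _
    · intro v _
      rw [Nat.add_assoc, Nat.add_assoc]; exact hzero _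
  refine .seq ((Halts.loop (I := DegreeInv n l)
    (fun k s hI hc => degreeLoop_step hlt (by omega) hI hc) hinv).mono ?_)
  rintro t₁ s₁ ⟨ht₁, hc₁, -, hfr, hin₁, h4, h14, h15, ⟨j, hj, -, h8, hd, hflag⟩, z₁, z₂⟩
  simp only [Test.Holds, h8, hfr.r5] at hc₁
  obtain rfl : j = l.length := by omega
  rw [List.take_length] at hd hflag
  have hge : ∀ v, n ≤ v → outD l v = 0 := by
    intro v hv
    by_contra hne
    obtain ⟨w, M', hM⟩ := exists_cons_of_outD_pos (Nat.pos_of_ne_zero hne)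
    have : (v, w) ∈ (l : Multiset (ℕ × ℕ)) := by rw [hM]; simp
    have := (hlt _ this).1
    simp only at this
    omega
  refine .ite (fun hc => ?_) (fun hc => ?_)
  · simp only [Test.Holds, hfr.r9] at hc
    have h2 : ∀ v, outD l v ≤ 2 := by
      intro v
      by_cases hv : v < n
      · exact hflag.1 hc v hv
      · rw [hge v (by omega)]; omega
    have hadm := hadm h2
    refine .seq (.block ?_ ?_)
    · simp [Fits, Instr.value, hfr.r2]; omega
    have hinv : SumInv n l (20 * (l.length - 0)) (run [.copy 8 2] s₁) := by
      refine ⟨hfr.congr fun r _ _ hr => ?_, hin₁, ?_, ?_, ?_, hd, ⟨0, by omega, rfl, ?_, ?_, ?_⟩⟩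
      · simp [run, Instr.next, hr]
      · simpa [run, Instr.next] using h4
      · simpa [run, Instr.next] using h14
      · simpa [run, Instr.next] using h15
      · simp [run, Instr.next, Instr.value, hfr.r2]
      · simpa [run, Instr.next] using z₁
      · simpa [run, Instr.next] using z₂
    refine .seq ((Halts.loop (I := SumInv n l)
      (fun k s hI hc => sumLoop_step hlt (by omega) h2 (fun v => hbal v ▸ h2 v) hI hc)
      hinv).mono ?_)
    rintro t₂ s₂ ⟨ht₂, hc₂, -, hfr, hin₂, h4, h14, h15, hd, ⟨j, hj, -, h8, hs, ht⟩⟩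
    simp only [Test.Holds, h8, hfr.r5] at hc₂
    obtain rfl : j = l.length := by omega
    rw [List.take_length] at hs ht
    have hinv : ReduceInv n l.length (AllCut l) (40 * (l.length + n)) s₂ := by
      refine ⟨hfr, l, hadm, Iff.rfl, hlt, le_rfl, ?_, h4, ?_, ?_, ?_, ?_, hd, fun v hv _ => hs v hv,
        fun v hv _ => ht v hv⟩
      · rw [h14]; simp
      · omega
      · omega
      · omega
      · intro v hv hne; omega
    refine .seq ((Halts.loop (I := ReduceInv n l.length (AllCut l))
      (fun k s hI hc => reduceLoop_step (by omega) hI hc) hinv).mono ?_)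
    rintro t₃ s₃ ⟨ht₃, hc₃, -, hfr, M, hM, hP, hltM, -, -, h4, h14, -, h15, hdone, -⟩
    simp only [Test.Holds, hfr.r3] at hc₃
    have h14 : s₃.reg 14 = n := by omega
    have hiff : AllCut l ↔ s₃.reg 4 = 0 := by
      rw [← hP, hM.allCut_iff_eq_zero, h4, Multiset.card_eq_zero]
      intro v hv
      obtain ⟨w, M', rfl⟩ := exists_cons_of_outD_pos (M := M) (v := v) (by omega)
      have := (hltM (v, w) (by simp)).1
      simp only at this
      -- The current node is now `n`, which is no node of the graph, so none is exempt from `hdone`.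
      exact hdone v (by omega) (by rw [h15 h14]; omega) hv
    rw [hiff]
    refine .ite (fun hc => ?_) (fun hc => ?_)
    · simp only [Test.Holds, hfr.r9] at hc
      refine .block (by simp [Fits, Instr.value]; omega) ⟨?_, ?_, ?_⟩
      · simp [initBlock]; omega
      · simp [run, Instr.next, Instr.value]
      · exact fun h => absurd hc h
    · simp only [Test.Holds, hfr.r9] at hc
      refine .skip ⟨?_, fun h => absurd h hc, fun _ => hfr.r0⟩
      simp [initBlock]; omega
  · simp only [Test.Holds, hfr.r9, hflag] at hc
    refine .skip ⟨?_, fun hall => ?_, fun _ => hfr.r0⟩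
    · simp [initBlock]; omega
    -- Rejection is correct because a degree above two already violates `AllCut`.
    · refine absurd (fun v _ => ?_) hc
      by_contra hlt
      rcases hall v (by show 0 < outD _ v; omega) with h | h <;> omega

end EulerianCircuits

theorem corollary1 :
    -- the characterization
    (∀ (V : Type*) [Finite V] (G : Digraph V),
      EulerianCircuits.Loopless G → EulerianCircuits.WeaklyConnected G →
      (EulerianCircuits.edgeSet G).Nonempty → EulerianCircuits.IsEulerian G →
      (EulerianCircuits.HasUniqueEulerianCircuit G ↔ EulerianCircuits.A G = Set.univ)) ∧
    -- the condition is decided in `O(|E|)` steps, on words below `O(|E|)`: register `0` holds the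
    -- answer, `1` for yes and `0` for no
    (∃ (P : EulerianCircuits.RAM.Program) (C : ℕ),
      ∀ (n : ℕ) (G : Digraph (Fin n)) (L : List (Fin n × Fin n)),
        EulerianCircuits.Loopless G → EulerianCircuits.WeaklyConnected G →
        (EulerianCircuits.edgeSet G).Nonempty → EulerianCircuits.IsEulerian G →
        EulerianCircuits.IsEdgeList G L →
        ∃ (t : ℕ) (s : EulerianCircuits.RAM.State),
          EulerianCircuits.RAM.Exec (C * (EulerianCircuits.edgeSet G).ncard) P
            (EulerianCircuits.initState n L) t s ∧
          t ≤ C * (EulerianCircuits.edgeSet G).ncard ∧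
          (EulerianCircuits.A G = Set.univ → s.reg 0 = 1) ∧
          (EulerianCircuits.A G ≠ Set.univ → s.reg 0 = 0)) := by
  refine ⟨fun V _ G hl hc hE he =>
    EulerianCircuits.hasUniqueEulerianCircuit_iff_A G hl hc hE he,
    EulerianCircuits.decideUnique, 200, fun n G L hl hc hE he h => ?_⟩
  rw [h.length_eq]
  exact EulerianCircuits.decideUnique_halts hl hc hE he h
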